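/- **Setting.** Let $(\mathsf X,\mathcal X)$ and $(\mathsf Y,\mathcal Y)$ be measurable spaces with $\sigma$-finite measures $\mu$ and $\nu$, let $\mathsf Z=\mathsf X\times\mathsf Y$, and let $(\Theta,d)$ be a compact metric space with its Borel $\sigma$-field. Let $q:\Theta\times\mathsf Z\times\mathsf Z\to[0,\infty]$, $(\theta,z,z')\mapsto q_\theta(z,z')$, be measurable with $\int q_\theta(z,z')\,(\mu\otimes\nu)(dz')=1$ for all $\theta,z$, and let $Q_\theta$ be the Markov kernel $Q_\theta(z,dz')=q_\theta(z,z')\,(\mu\otimes\nu)(dz')$. For a probability measure $\eta$ on $\mathsf Z$, $\mathbb P^\theta_\eta$ is the law of the canonical Markov chain $Z_n=(X_n,Y_n)$, $n\ge 0$, with kernel $Q_\theta$ and initial law $\eta$; only $Y_1,Y_2,\dots$ are observed. Write $$p_{\theta,\eta}(y_{1:n})=\int\prod_{\ell=0}^{n-1}q_\theta(z_\ell,z_{\ell+1})\,\eta(dz_0)\,\mu^{\otimes n}(dx_{1:n}),\qquad z_\ell=(x_\ell,y_\ell)\ \text{ for } 1\le \ell\le n .$$ For a finite measure $\lambda$ on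 $\Theta$ (the prior) and a probability measure $\eta$ on $\mathsf Z$, the posterior is $$\Pi_{y_{1:n}}(A)=\frac{\int_A p_{\theta,\eta}(y_{1:n})\,\lambda(d\theta)}{\int_\Theta p_{\theta,\eta}(y_{1:n})\,\lambda(d\theta)} .$$ **Theorem.** Fix $\theta_\star\in\Theta$, a finite measure $\lambda$ on $\Theta$ and a probability measure $\eta$ on $\mathsf Z$, and suppose that the following hold. * (B1) For every $\theta$, $Q_\theta$ has a unique stationary probability distribution $\pi_\theta$. Put $\pi_\star=\pi_{\theta_\star}$. * (B2) For every compact $K\subseteq\Theta$ containing $\theta_\star$, every $K$-valued sequence $(\hat\theta_n)_{n\ge1}$, with $\hat\theta_n$ measurable with respect to $\sigma(Y_1,\dots,Y_n)$, such that, $\mathbb P^{\theta_\star}_{\pi_\star}$-a.s., $n^{-1}\log p_{\hat\theta_n,\eta}(Y_{1:n})\ge n^{-1}\log p_{\theta_\star,\pi_\star}(Y_{1:n})+\epsilon_n$ for all $n\ge1$ with $\epsilon_n\to0$, converges to $\theta_\star$, $\mathbb P^{\theta_\star}_{\pi_\star}$-a.s. * (C1) For all $\theta$ and all $(x,y),(x',y')\in\mathsf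 Z$, $q_\theta((x,y),(x',y'))=q^X_\theta(x,x')\,g_\theta(x',y')$, where, for each $\theta$, $q^X_\theta$ and $g_\theta$ are nonnegative (possibly $+\infty$-valued) measurable functions on $\mathsf X\times\mathsf X$ and $\mathsf X\times\mathsf Y$ with $\int q^X_\theta(x,x')\,\mu(dx')=1$ and $\int g_\theta(x,y)\,\nu(dy)=1$ for all $x$. Let $Q^X_\theta(x,dx')=q^X_\theta(x,x')\,\mu(dx')$. * (C2) For all $\theta$ and $x$, $g_\theta(x,y)>0$ for $\nu$-a.e. $y$. * (C3) For all $\delta>0$, $\lambda(\{\theta:\overline\Delta(\theta_\star,\theta)\le\delta\})>0$, where $$\overline\Delta(\theta_\star,\theta)=\int \mathrm{KL}\big(g_{\theta_\star}(x,\cdot)\,\nu\,\big\|\,g_\theta(x',\cdot)\,\nu\big)\,\pi_\star(dx\times\mathsf Y)\,\pi_\theta(dx'\times\mathsf Y)\in[0,\infty]$$ and $\mathrm{KL}(P\|Q)=\int\log\frac{dP}{dQ}\,dP$ if $P\ll Q$, and $\infty$ otherwise. * (C4) For all $\theta$ and all probability measures $\xi$ on $\mathsf X$, $\lim_{n\to\infty}\|\xi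 (Q^X_\theta)^n-\pi_\theta(\cdot\times\mathsf Y)\|_{\mathrm{TV}}=0$. Then, for every probability measure $\eta_\star$ on $\mathsf Z$, $\mathbb P^{\theta_\star}_{\eta_\star}$-almost surely, $\Pi_{Y_{1:n}}$ is a well-defined probability measure for all large $n$ and converges weakly to the Dirac mass $\delta_{\theta_\star}$ as $n\to\infty$. -/

import Mathlib

open MeasureTheory ProbabilityTheory Filter Topology
open scoped ENNReal

namespace BayesPOMM

/-- Law of the canonical Markov chain `(Z_n)_{n ≥ 0}` on `ℕ → Z` with initial distribution `η`
and Markov transition kernel `κ`. -/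
noncomputable def chainLaw {Z : Type*} [MeasurableSpace Z] (κ : Kernel Z Z) [IsMarkovKernel κ]
    (η : Measure Z) : Measure (ℕ → Z) :=
  Kernel.trajMeasure (X := fun _ => Z) η
    (fun n => κ.comap (fun h : (Finset.Iic n) → Z => h ⟨n, Finset.mem_Iic.2 le_rfl⟩)
      (measurable_pi_apply _))

/-- `π` is a stationary probability distribution of `κ`, and it is the only one. -/
def IsUniqueStationary {Z : Type*} [MeasurableSpace Z] (κ : Kernel Z Z) (π : Measure Z) : Prop :=
  IsProbabilityMeasure π ∧ κ.Invariant π ∧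
    ∀ ρ : Measure Z, IsProbabilityMeasure ρ → κ.Invariant ρ → ρ = π

/-- The total variation norm `‖ρ - σ‖_TV` of the difference of two finite measures. -/
noncomputable def tvNormSub {S : Type*} [MeasurableSpace S] (ρ σ : Measure S)
    [IsFiniteMeasure ρ] [IsFiniteMeasure σ] : ℝ≥0∞ :=
  (ρ.toSignedMeasure - σ.toSignedMeasure).totalVariation Set.univ

/-- The measures `m n` are probability measures for all large `n`, and converge weakly to the
probability measure `l`. -/
def EventuallyProbTendstoWeakly {T : Type*} [TopologicalSpace T] [MeasurableSpace T]
    [OpensMeasurableSpace T] (m : ℕ → Measure T) (l : ProbabilityMeasure T) : Prop :=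
  ∃ p : ℕ → ProbabilityMeasure T,
    (∀ᶠ n in atTop, (p n : Measure T) = m n) ∧ Tendsto p atTop (𝓝 l)

/-- A fully dominated partially observed Markov model, with parameter space `Θ`, state space `X`,
observation space `Y` and dominating measures `μ` on `X` and `ν` on `Y`: it is given by the
transition densities `q θ z z'` with respect to `μ ⊗ ν`. -/
structure FDPOMM (Θ X Y : Type*) [MeasurableSpace Θ] [MeasurableSpace X] [MeasurableSpace Y]
    (μ : Measure X) (ν : Measure Y) where
  /-- transition density -/
  q : Θ → X × Y → X × Y → ℝ≥0∞
  measurable_q : Measurable fun p : Θ × (X × Y) × (X × Y) => q p.1 p.2.1 p.2.2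
  lintegral_q : ∀ θ z, ∫⁻ z', q θ z z' ∂(μ.prod ν) = 1

/-- The observations `Y_1, …, Y_n` of a trajectory `(Z_0, Z_1, …)`; `Y_0` is not observed. -/
def obs {X Y : Type*} (n : ℕ) (ω : ℕ → X × Y) : Fin n → Y := fun i => (ω ((i : ℕ) + 1)).2

/-- The σ-field generated by `Y_1, …, Y_n`. -/
abbrev obsField (X Y : Type*) [MeasurableSpace Y] (n : ℕ) : MeasurableSpace (ℕ → X × Y) :=
  MeasurableSpace.comap (obs n) inferInstance

namespace FDPOMM

variable {Θ X Y : Type*} [MeasurableSpace Θ] [MeasurableSpace X] [MeasurableSpace Y]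
  {μ : Measure X} {ν : Measure Y} [SigmaFinite μ] [SigmaFinite ν]

/-- The transition kernel `Q_θ(z, dz') = q_θ(z, z') (μ ⊗ ν)(dz')`. -/
noncomputable def Q (M : FDPOMM Θ X Y μ ν) (θ : Θ) : Kernel (X × Y) (X × Y) :=
  Kernel.withDensity (Kernel.const (X × Y) (μ.prod ν)) (M.q θ)

theorem Q_apply (M : FDPOMM Θ X Y μ ν) (θ : Θ) (z : X × Y) :
    M.Q θ z = (μ.prod ν).withDensity (M.q θ z) := by
  have h : Measurable (Function.uncurry (M.q θ)) :=
    M.measurable_q.comp (measurable_prodMk_left (x := θ))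
  rw [Q, Kernel.withDensity_apply _ h, Kernel.const_apply]

instance (M : FDPOMM Θ X Y μ ν) (θ : Θ) : IsMarkovKernel (M.Q θ) :=
  ⟨fun z => ⟨by rw [Q_apply, withDensity_apply _ MeasurableSet.univ, Measure.restrict_univ,
    M.lintegral_q]⟩⟩

/-- `ℙ^θ_η`, the law of the complete chain under parameter `θ` and initial distribution `η`. -/
noncomputable def law (M : FDPOMM Θ X Y μ ν) (θ : Θ) (η : Measure (X × Y)) :
    Measure (ℕ → X × Y) :=
  chainLaw (M.Q θ) η

/-- The density `p_{θ,η}(y_{1:n})` of `Y_{1:n}` with respect to `ν^{⊗n}` under `ℙ^θ_η`: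
`∫ q_θ(z_0, z_1) q_θ(z_1, z_2) ⋯ q_θ(z_{n-1}, z_n) η(dz_0) μ^{⊗n}(dx_{1:n})`, where
`z_ℓ = (x_ℓ, y_ℓ)` for `1 ≤ ℓ ≤ n`. -/
noncomputable def likelihood (M : FDPOMM Θ X Y μ ν) (θ : Θ) (η : Measure (X × Y)) {n : ℕ}
    (y : Fin n → Y) : ℝ≥0∞ :=
  ∫⁻ z₀, ∫⁻ x : Fin n → X,
    (let z : Fin (n + 1) → X × Y := Fin.cons z₀ (fun i => (x i, y i))
     ∏ i : Fin n, M.q θ (z i.castSucc) (z i.succ))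
    ∂(Measure.pi fun _ => μ) ∂η

/-- The posterior `A ↦ ∫_A p_{θ,η}(y_{1:n}) λ(dθ) / ∫_Θ p_{θ,η}(y_{1:n}) λ(dθ)` for the prior
`lam` and the initial distribution `η`. -/
noncomputable def posterior (M : FDPOMM Θ X Y μ ν) (lam : Measure Θ) (η : Measure (X × Y)) {n : ℕ}
    (y : Fin n → Y) : Measure Θ :=
  (∫⁻ θ, M.likelihood θ η y ∂lam)⁻¹ • lam.withDensity (fun θ => M.likelihood θ η y)

/-- Consistency of approximate maximum likelihood estimators on compact sets: for every compact
`K` containing `θs`, every `K`-valued sequence `(θhat_n)_{n ≥ 1}` adapted to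
`σ(Y_1, …, Y_n)` such that, `ℙ^{θs}_{πs}`-a.s.,
`n⁻¹ log p_{θhat_n,η}(Y_{1:n}) ≥ n⁻¹ log p_{θs,πs}(Y_{1:n}) + ε_n` for all `n ≥ 1`
with `ε_n → 0`, converges `ℙ^{θs}_{πs}`-a.s. to `θs`. -/
def ApproxMLEConsistent [TopologicalSpace Θ] (M : FDPOMM Θ X Y μ ν) (θs : Θ)
    (πs η : Measure (X × Y)) : Prop :=
  ∀ K : Set Θ, IsCompact K → θs ∈ K →
    ∀ (θhat : ℕ → (ℕ → X × Y) → Θ) (ε : ℕ → (ℕ → X × Y) → ℝ),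
      (∀ n, 1 ≤ n → Measurable[obsField X Y n] (θhat n)) →
      (∀ n, 1 ≤ n → ∀ ω, θhat n ω ∈ K) →
      (∀ᵐ ω ∂(M.law θs πs),
        (∀ n : ℕ, 1 ≤ n →
          (((n : ℝ)⁻¹ : ℝ) : EReal) * ENNReal.log (M.likelihood θs πs (obs n ω)) + (ε n ω : EReal)
            ≤ (((n : ℝ)⁻¹ : ℝ) : EReal) * ENNReal.log (M.likelihood (θhat n ω) η (obs n ω))) ∧
        Tendsto (fun n => ε n ω) atTop (𝓝 0)) →
      ∀ᵐ ω ∂(M.law θs πs), Tendsto (fun n => θhat n ω) atTop (𝓝 θs)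

/-- The model is a hidden Markov model: `q_θ((x,y),(x',y')) = qX_θ(x,x') g_θ(x',y')`, where
`qX_θ` and `g_θ` are Markov kernel densities with respect to `μ` and `ν`. -/
structure HMM (M : FDPOMM Θ X Y μ ν) where
  /-- transition density of the hidden chain -/
  qX : Θ → X → X → ℝ≥0∞
  /-- emission density -/
  g : Θ → X → Y → ℝ≥0∞
  measurable_qX : ∀ θ, Measurable (Function.uncurry (qX θ))
  measurable_g : ∀ θ, Measurable (Function.uncurry (g θ))
  lintegral_qX : ∀ θ x, ∫⁻ x', qX θ x x' ∂μ = 1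
  lintegral_g : ∀ θ x, ∫⁻ y, g θ x y ∂ν = 1
  q_eq : ∀ θ (z z' : X × Y), M.q θ z z' = qX θ z.1 z'.1 * g θ z'.1 z'.2

namespace HMM

variable {M : FDPOMM Θ X Y μ ν}

/-- The transition kernel of the hidden chain. -/
noncomputable def QX (H : M.HMM) (θ : Θ) : Kernel X X :=
  Kernel.withDensity (Kernel.const X μ) (H.qX θ)

instance (H : M.HMM) (θ : Θ) : IsMarkovKernel (H.QX θ) :=
  ⟨fun x => ⟨by rw [QX, Kernel.withDensity_apply _ (H.measurable_qX θ), Kernel.const_apply,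
    withDensity_apply _ MeasurableSet.univ, Measure.restrict_univ, H.lintegral_qX]⟩⟩

instance (H : M.HMM) (θ : Θ) (n : ℕ) : IsMarkovKernel (H.QX θ ^ n) := by
  induction n with
  | zero => rw [pow_zero]; exact inferInstanceAs (IsMarkovKernel Kernel.id)
  | succ n ih => rw [pow_succ]; exact inferInstanceAs (IsMarkovKernel ((H.QX θ ^ n) ∘ₖ H.QX θ))

/-- `∫ KL(g_{θs}(x,·) ‖ g_θ(x',·)) π_{θs}(dx × Y) π_θ(dx' × Y)`, where `π` assigns to each parameter
its stationary distribution. -/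
noncomputable def emissionKL (H : M.HMM) (π : Θ → Measure (X × Y)) (θs θ : Θ) : ℝ≥0∞ :=
  ∫⁻ p, InformationTheory.klDiv (ν.withDensity (H.g θs p.1)) (ν.withDensity (H.g θ p.2))
    ∂((π θs).fst.prod (π θ).fst)

end HMM

end FDPOMM

end BayesPOMM

/-! The divergence in (C3) integrates over independent hidden states `x` and `x'`, and this is very
restrictive. If the integral is small for some `θ`, a single `x'` can be fixed for which `g_θ(x',
·)` is close to `g_θs(x, ·)` on average over `x`. The densities `g_θs(x, ·)` are then close to each
other in `L¹`. As arbitrarily small values occur, `g_θs(x, ·)` equals one density `gs` for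
stationary-almost every `x` (`exists_ae_g_eq`). Under the stationary law the observations are
therefore i.i.d. with density `gs`, and the likelihood of `(θs, π θs)` is almost surely `∏ gs (y
i)`. No ergodic theory beyond the strong law for i.i.d. variables is needed.

Denominator of the posterior. Put `cost = log⁺ (gs / g_θ)`. Jensen's inequality along the hidden
chain bounds the likelihood of `θ` from below by `∏ gs (y i)` times the exponential of minus an
expected cumulative cost. Under the stationary law of `θ` this expectation is a sum of i.i.d. terms,
of small mean when the divergence is small. An arbitrary initial law is handled by waiting `m`
steps, until the hidden law is within `1/4` of stationarity in total variation. Since `g_θ > 0`, the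
unnormalised filter at time `m` dominates the hidden law, so a multiple of it lies above at least
half of the stationary law (`exists_mul_le_lintegral_condLik`). Integrating over the prior, which
charges parameters of small divergence, gives a denominator eventually above `c * exp (-δ n) * ∏ gs
(y i)` for every `δ` (`ae_exists_mul_le_lintegral`).

Numerator. Let `A` be closed with `θs ∉ A`. If the likelihood integrated over `A` were not
exponentially small compared with `∏ gs (y i)`, an estimator could infinitely often take values in
`A` while maximising the likelihood up to a vanishing rate, contradicting (B2). The estimator is
built from the observations alone: it pursues a target of rate `1/(j+1)`, moves to `j+1` after each
success, and takes the value `θs` at other times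
(`ApproxMLEConsistent.ae_eventually_setLIntegral_le`).

Arbitrary true initial law. Once the hidden chain is in the region of constant emission it stays
there, and the later observations are i.i.d. and independent of the past. By (C4) that region is
reached with probability tending to one. Hence the law of the observations is absolutely continuous
with respect to the stationary one, and almost sure statements transfer
(`map_obsSeq_absolutelyContinuous`). -/

set_option linter.unusedSectionVars false

/-! ### Inequalities for `log⁺`, `exp (-v)` and the Kullback-Leibler divergence. -/

namespace BayesPOMM

/-- The positive part of the logarithm, on extended nonnegative reals. -/
noncomputable def logPlus (r : ℝ≥0∞) : ℝ≥0∞ :=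
  if r = ⊤ then ⊤ else ENNReal.ofReal (Real.log r.toReal)

/-- The function `v ↦ exp (-v)` on extended nonnegative reals. -/
noncomputable def negExp (v : ℝ≥0∞) : ℝ≥0∞ :=
  if v = ⊤ then 0 else ENNReal.ofReal (Real.exp (-v.toReal))

theorem measurable_logPlus : Measurable logPlus :=
  Measurable.ite (measurableSet_singleton _) measurable_const (by fun_prop)

theorem measurable_negExp : Measurable negExp :=
  Measurable.ite (measurableSet_singleton _) measurable_const (by fun_prop)

@[simp] theorem negExp_top : negExp ⊤ = 0 := by simp [negExp]

theorem negExp_ofReal {v : ℝ} (hv : 0 ≤ v) :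
    negExp (ENNReal.ofReal v) = ENNReal.ofReal (Real.exp (-v)) := by
  simp [negExp, ENNReal.toReal_ofReal hv]

@[simp] theorem negExp_zero : negExp 0 = 1 := by simp [negExp]

theorem negExp_add (u v : ℝ≥0∞) : negExp (u + v) = negExp u * negExp v := by
  by_cases hu : u = ⊤
  · simp [hu]
  by_cases hv : v = ⊤
  · simp [hv]
  simp only [negExp, hu, hv, ENNReal.add_eq_top, or_self, if_false]
  rw [← ENNReal.ofReal_mul (Real.exp_nonneg _), ← Real.exp_add, ENNReal.toReal_add hu hv]
  congr 2
  ring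

theorem negExp_antitone : Antitone negExp := by
  intro u v h
  by_cases hv : v = ⊤
  · simp [hv]
  have hu : u ≠ ⊤ := ne_top_of_le_ne_top hv h
  simp only [negExp, hu, hv, if_false]
  exact ENNReal.ofReal_le_ofReal (Real.exp_le_exp.2 (neg_le_neg (ENNReal.toReal_mono hv h)))

/-- The left side is `min a b`. This lets a cost stand in for the ratio of a single emission factor
to `gs`. -/
theorem mul_negExp_logPlus_le {a : ℝ≥0∞} (ha : a ≠ ⊤) (b : ℝ≥0∞) :
    a * negExp (logPlus (a / b)) ≤ b := by
  by_cases hb : b = ⊤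
  · simp [hb]
  by_cases ha0 : a = 0
  · simp [ha0]
  by_cases hb0 : b = 0
  · simp [hb0, ENNReal.div_zero ha0, logPlus]
  lift a to NNReal using ha
  lift b to NNReal using hb
  have ha' : (0 : ℝ) < a := by exact_mod_cast pos_iff_ne_zero.2 ha0
  have hb' : (0 : ℝ) < b := by exact_mod_cast pos_iff_ne_zero.2 hb0
  have hne : (a : ℝ≥0∞) / b ≠ ⊤ := ENNReal.div_ne_top ENNReal.coe_ne_top hb0
  rw [logPlus, if_neg hne, negExp, if_neg ENNReal.ofReal_ne_top, ENNReal.toReal_ofReal',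
    ENNReal.toReal_div, ENNReal.coe_toReal, ENNReal.coe_toReal]
  rw [← ENNReal.ofReal_coe_nnreal, ← ENNReal.ofReal_coe_nnreal, ← ENNReal.ofReal_mul ha'.le]
  apply ENNReal.ofReal_le_ofReal
  calc (a : ℝ) * Real.exp (-max (Real.log (a / b)) 0)
      ≤ a * Real.exp (-Real.log (a / b)) := by gcongr; exact le_max_left _ _
    _ = b := by
      rw [Real.exp_neg, Real.exp_log (by positivity)]
      field_simp

/-- This is `1 - 1/t ≤ log t` at `t = a / b`, multiplied by `a`. Integrated, it bounds an `L¹`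
distance by a cost. -/
theorem tsub_le_mul_logPlus {a : ℝ≥0∞} (ha : a ≠ ⊤) (b : ℝ≥0∞) :
    a - b ≤ a * logPlus (a / b) := by
  by_cases hb : b = ⊤
  · simp [hb]
  by_cases ha0 : a = 0
  · simp [ha0]
  by_cases hb0 : b = 0
  · simp [hb0, ENNReal.div_zero ha0, logPlus, ENNReal.mul_top ha0]
  lift a to NNReal using ha
  lift b to NNReal using hb
  have ha' : (0 : ℝ) < a := by exact_mod_cast pos_iff_ne_zero.2 ha0
  have hb' : (0 : ℝ) < b := by exact_mod_cast pos_iff_ne_zero.2 hb0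
  have hne : (a : ℝ≥0∞) / b ≠ ⊤ := ENNReal.div_ne_top ENNReal.coe_ne_top hb0
  rw [logPlus, if_neg hne, ENNReal.toReal_div, ENNReal.coe_toReal, ENNReal.coe_toReal]
  rw [← ENNReal.ofReal_coe_nnreal, ← ENNReal.ofReal_coe_nnreal, ← ENNReal.ofReal_mul ha'.le,
    ← ENNReal.ofReal_sub _ hb'.le]
  apply ENNReal.ofReal_le_ofReal
  have h := Real.one_sub_inv_le_log_of_pos (show (0 : ℝ) < a / b by positivity)
  have : (a : ℝ) - b = a * (1 - (a / b : ℝ)⁻¹) := by field_simp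
  rw [this]
  gcongr

/-- The convex function `exp (-v)` lies above its tangent at `c`; the term of negative slope is
moved to the right, which avoids truncated subtraction. -/
theorem ofReal_le_negExp_add (c : ℝ) (v : ℝ≥0∞) :
    ENNReal.ofReal (Real.exp (-c) * (1 + c)) ≤ negExp v + ENNReal.ofReal (Real.exp (-c)) * v := by
  by_cases hv : v = ⊤
  · rw [hv, ENNReal.mul_top]
    · simp
    · simpa using Real.exp_pos _
  lift v to NNReal using hv
  rw [negExp, if_neg ENNReal.coe_ne_top, ENNReal.coe_toReal]
  rw [← ENNReal.ofReal_coe_nnreal, ← ENNReal.ofReal_mul (Real.exp_nonneg _), ← ENNReal.ofReal_add (Real.exp_nonneg _)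
    (by positivity)]
  apply ENNReal.ofReal_le_ofReal
  have h := Real.add_one_le_exp (c - v)
  have h2 : Real.exp (-(v : ℝ)) = Real.exp (-c) * Real.exp (c - v) := by
    rw [← Real.exp_add]; congr 1; ring
  rw [h2]
  nlinarith [Real.exp_pos (-c)]

/-- Jensen's inequality for `v ↦ exp (-v)`. -/
theorem negExp_lintegral_le {α : Type*} [MeasurableSpace α] (m : Measure α)
    [IsProbabilityMeasure m] {f : α → ℝ≥0∞} (hf : Measurable f) :
    negExp (∫⁻ x, f x ∂m) ≤ ∫⁻ x, negExp (f x) ∂m := by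
  by_cases htop : ∫⁻ x, f x ∂m = ⊤
  · simp [htop]
  set c := (∫⁻ x, f x ∂m).toReal with hc
  have hc0 : 0 ≤ c := ENNReal.toReal_nonneg
  have h : ∫⁻ _, ENNReal.ofReal (Real.exp (-c) * (1 + c)) ∂m
      ≤ ∫⁻ x, (negExp (f x) + ENNReal.ofReal (Real.exp (-c)) * f x) ∂m :=
    lintegral_mono fun x => ofReal_le_negExp_add c (f x)
  rw [lintegral_const, measure_univ, mul_one, lintegral_add_right _ (by fun_prop),
    lintegral_const_mul _ hf, ← ENNReal.ofReal_toReal htop, ← hc,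
    ← ENNReal.ofReal_mul (Real.exp_nonneg _), mul_add, mul_one,
    ENNReal.ofReal_add (Real.exp_nonneg _) (by positivity)] at h
  rw [negExp, if_neg htop, ← hc]
  exact (ENNReal.add_le_add_iff_right ENNReal.ofReal_ne_top).1 h

/-- Jensen's inequality for `m` conditioned on `A`: conditioning multiplies the integral of `f` by
at most `1 / m A ≤ 2`, which is the factor in the exponent. -/
theorem half_mul_negExp_le {α : Type*} [MeasurableSpace α] (m : Measure α)
    [IsProbabilityMeasure m] {f : α → ℝ≥0∞} (hf : Measurable f) {A : Set α}
    (hA : 2⁻¹ ≤ m A) :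
    2⁻¹ * negExp (2 * ∫⁻ x, f x ∂m) ≤ ∫⁻ x in A, negExp (f x) ∂m := by
  have hA0 : m A ≠ 0 := (lt_of_lt_of_le (by simp) hA).ne'
  have hpr : IsProbabilityMeasure ((m A)⁻¹ • m.restrict A) :=
    ⟨by simp [ENNReal.inv_mul_cancel hA0 (measure_ne_top m A)]⟩
  have h := negExp_lintegral_le ((m A)⁻¹ • m.restrict A) hf
  rw [lintegral_smul_measure, lintegral_smul_measure, smul_eq_mul, smul_eq_mul] at h
  have h1 : (m A)⁻¹ ≤ 2 := by simpa using ENNReal.inv_le_inv.2 hA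
  have h2 : negExp (2 * ∫⁻ x, f x ∂m) ≤ (m A)⁻¹ * ∫⁻ x in A, negExp (f x) ∂m := by
    refine le_trans (negExp_antitone ?_) h
    gcongr
    exact Measure.restrict_le_self
  calc 2⁻¹ * negExp (2 * ∫⁻ x, f x ∂m)
      ≤ m A * ((m A)⁻¹ * ∫⁻ x in A, negExp (f x) ∂m) := by gcongr
    _ = _ := by rw [← mul_assoc, ENNReal.mul_inv_cancel hA0 (measure_ne_top m A), one_mul]

/-- For `x > 1` one has `x log x = klFun x + (x - 1)`. The excess satisfies `x - 1 ≤ 2 (√x - 1) √x`,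
which is split by Young's inequality with weight `ε`, and `(√x - 1)² ≤ klFun x`. Thus keeping only
the positive part of the logarithm costs an arbitrarily small error. -/
theorem mul_log_le_klFun {ε : ℝ} (hε : 0 < ε) {x : ℝ} (hx : 0 ≤ x) :
    x * max (Real.log x) 0 ≤ (1 + ε⁻¹) * InformationTheory.klFun x + ε * x := by
  have hkl : 0 ≤ InformationTheory.klFun x := InformationTheory.klFun_nonneg hx
  rcases le_or_gt x 1 with h1 | h1
  · rw [max_eq_right (Real.log_nonpos hx h1), mul_zero]
    exact add_nonneg (mul_nonneg (by positivity) hkl) (by positivity)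
  have hs : 0 < √x := Real.sqrt_pos.2 (by linarith)
  have hsq : √x * √x = x := Real.mul_self_sqrt hx
  rw [max_eq_left (Real.log_nonneg h1.le)]
  have hlog : Real.log x = 2 * Real.log √x := by
    rw [Real.log_sqrt hx]; ring
  have hlow := Real.one_sub_inv_le_log_of_pos hs
  have key : (√x - 1) ^ 2 ≤ InformationTheory.klFun x := by
    have h3 : x * (1 - (√x)⁻¹) = x - √x := by
      rw [mul_sub, mul_one]
      congr 1
      nth_rw 1 [← hsq]
      field_simp
    rw [InformationTheory.klFun, hlog]
    nlinarith [mul_le_mul_of_nonneg_left hlow hx]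
  have e1 : x * Real.log x = InformationTheory.klFun x + (x - 1) := by
    rw [InformationTheory.klFun]; ring
  have h5 : x - 1 ≤ ε⁻¹ * (√x - 1) ^ 2 + ε * x := by
    have hs1 : 1 ≤ √x := Real.one_le_sqrt.2 h1.le
    have h6 : x - 1 ≤ 2 * ((√x - 1) * √x) := by nlinarith
    have h7 : 0 ≤ ε⁻¹ * ((√x - 1) - ε * √x) ^ 2 := by positivity
    have h8 : ε⁻¹ * ((√x - 1) - ε * √x) ^ 2
        = ε⁻¹ * (√x - 1) ^ 2 - 2 * ((√x - 1) * √x) + ε * (√x * √x) := by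
      field_simp; ring
    rw [h8, hsq] at h7
    linarith
  have h9 : ε⁻¹ * (√x - 1) ^ 2 ≤ ε⁻¹ * InformationTheory.klFun x := by gcongr
  rw [e1]
  linarith

theorem lintegral_mul_logPlus_le_klDiv {Y : Type*} [MeasurableSpace Y] {ν : Measure Y}
    [SigmaFinite ν] {a b : Y → ℝ≥0∞} (ha : Measurable a) (hb : Measurable b)
    (ha1 : ∫⁻ y, a y ∂ν = 1) (hb1 : ∫⁻ y, b y ∂ν = 1) (hb0 : ∀ᵐ y ∂ν, 0 < b y)
    {ε : ℝ} (hε : 0 < ε) :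
    ∫⁻ y, a y * logPlus (a y / b y) ∂ν
      ≤ ENNReal.ofReal (1 + ε⁻¹) *
          InformationTheory.klDiv (ν.withDensity a) (ν.withDensity b) + ENNReal.ofReal ε := by
  have hat : ∀ᵐ y ∂ν, a y < ⊤ := ae_lt_top ha (by simp [ha1])
  have hbt : ∀ᵐ y ∂ν, b y < ⊤ := ae_lt_top hb (by simp [hb1])
  have : IsProbabilityMeasure (ν.withDensity a) := ⟨by simp [ha1]⟩
  have : IsProbabilityMeasure (ν.withDensity b) := ⟨by simp [hb1]⟩
  have hr : Measurable fun y => a y / b y := ha.div hb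
  have heq : ν.withDensity a = (ν.withDensity b).withDensity (fun y => a y / b y) := by
    rw [← withDensity_mul _ hb hr]
    refine withDensity_congr_ae ?_
    filter_upwards [hb0, hbt] with y h0 ht
    simp [ENNReal.mul_div_cancel h0.ne' ht.ne]
  have hac : ν.withDensity a ≪ ν.withDensity b := by
    rw [heq]; exact withDensity_absolutelyContinuous _ _
  have hrn : (ν.withDensity a).rnDeriv (ν.withDensity b) =ᵐ[ν.withDensity b]
      fun y => a y / b y := by
    rw [heq]; exact Measure.rnDeriv_withDensity _ hr
  rw [InformationTheory.klDiv_eq_lintegral_klFun_of_ac hac]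
  have h1 : ∫⁻ y, a y * logPlus (a y / b y) ∂ν
      = ∫⁻ y, a y / b y * logPlus (a y / b y) ∂(ν.withDensity b) := by
    have hm : Measurable fun y => a y / b y * logPlus (a y / b y) :=
      hr.mul (measurable_logPlus.comp hr)
    rw [lintegral_withDensity_eq_lintegral_mul _ hb hm]
    refine lintegral_congr_ae ?_
    filter_upwards [hb0, hbt] with y h0 ht
    simp only [Pi.mul_apply]
    rw [← mul_assoc, ENNReal.mul_div_cancel h0.ne' ht.ne]
  have h2 : ∫⁻ y, a y / b y ∂(ν.withDensity b) = 1 := by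
    rw [← setLIntegral_univ, ← withDensity_apply _ MeasurableSet.univ, ← heq, measure_univ]
  have hbν : ∀ᵐ y ∂(ν.withDensity b), a y / b y < ⊤ := by
    refine ae_lt_top hr (by simp [h2])
  have h3 : ∫⁻ y, a y / b y * logPlus (a y / b y) ∂(ν.withDensity b)
      ≤ ∫⁻ y, (ENNReal.ofReal (1 + ε⁻¹) * ENNReal.ofReal (InformationTheory.klFun
          ((ν.withDensity a).rnDeriv (ν.withDensity b) y).toReal)
        + ENNReal.ofReal ε * (a y / b y)) ∂(ν.withDensity b) := by
    refine lintegral_mono_ae ?_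
    filter_upwards [hrn, hbν] with y hy ht
    rw [hy]
    set x := a y / b y
    obtain ⟨t, ht0, hxt⟩ : ∃ t : ℝ, 0 ≤ t ∧ x = ENNReal.ofReal t :=
      ⟨x.toReal, ENNReal.toReal_nonneg, (ENNReal.ofReal_toReal ht.ne).symm⟩
    have hkl : 0 ≤ InformationTheory.klFun t := InformationTheory.klFun_nonneg ht0
    have hε' : 0 ≤ 1 + ε⁻¹ := by positivity
    rw [logPlus, if_neg ht.ne, hxt, ENNReal.toReal_ofReal ht0, ← ENNReal.ofReal_mul hε',
      ← ENNReal.ofReal_mul hε.le, ← ENNReal.ofReal_add (mul_nonneg hε' hkl) (by positivity)]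
    have : ENNReal.ofReal (Real.log t) = ENNReal.ofReal (max (Real.log t) 0) := by
      rw [ENNReal.ofReal_max, ENNReal.ofReal_zero, max_eq_left zero_le]
    rw [this, ← ENNReal.ofReal_mul ht0]
    exact ENNReal.ofReal_le_ofReal (mul_log_le_klFun hε ht0)
  rw [h1]
  refine h3.trans ?_
  rw [lintegral_add_right _ (by fun_prop), lintegral_const_mul _ hr, h2, mul_one,
    lintegral_const_mul]
  exact ENNReal.measurable_ofReal.comp (InformationTheory.measurable_klFun.comp
    (Measure.measurable_rnDeriv _ _).ennreal_toReal)

/-- Adding the common mass `1` to either side gives the integral of `max (a y) (b y)`. -/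
theorem lintegral_tsub_comm {Y : Type*} [MeasurableSpace Y] {ν : Measure Y}
    {a b : Y → ℝ≥0∞} (ha : Measurable a) (hb : Measurable b)
    (ha1 : ∫⁻ y, a y ∂ν = 1) (hb1 : ∫⁻ y, b y ∂ν = 1) :
    ∫⁻ y, (a y - b y) ∂ν = ∫⁻ y, (b y - a y) ∂ν := by
  have h1 : ∫⁻ y, (a y - b y) ∂ν + 1 = ∫⁻ y, (b y - a y) ∂ν + 1 := by
    rw [← hb1, ← lintegral_add_right _ hb, hb1, ← ha1, ← lintegral_add_right _ ha]
    simp_rw [tsub_add_eq_max, max_comm]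
  exact (ENNReal.add_left_inj ENNReal.one_ne_top).1 h1

end BayesPOMM

/-! ### The canonical chain, its observations and its hidden component. -/

namespace BayesPOMM

section Chain

variable {Z : Type*} [MeasurableSpace Z]

/-- The σ-field generated by the coordinates `0, …, n` of a trajectory. -/
abbrev pastField (Z : Type*) [MeasurableSpace Z] (n : ℕ) : MeasurableSpace (ℕ → Z) :=
  MeasurableSpace.comap (Preorder.frestrictLe (π := fun _ => Z) n) inferInstance

theorem pastField_le (n : ℕ) : pastField Z n ≤ MeasurableSpace.pi :=
  (Preorder.measurable_frestrictLe (X := fun _ => Z) n).comap_le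

theorem measurable_eval_pastField {i n : ℕ} (h : i ≤ n) :
    Measurable[pastField Z n] fun ω : ℕ → Z => ω i :=
  (measurable_pi_apply (⟨i, Finset.mem_Iic.2 h⟩ : Finset.Iic n)).comp
    (comap_measurable (Preorder.frestrictLe (π := fun _ => Z) n))

theorem pastField_mono {m n : ℕ} (h : m ≤ n) : pastField Z m ≤ pastField Z n := by
  refine Measurable.comap_le ((@measurable_pi_iff _ _ _ (pastField Z n) _ _).2 fun i => ?_)
  exact measurable_eval_pastField ((Finset.mem_Iic.1 i.2).trans h)

instance (κ : Kernel Z Z) [IsMarkovKernel κ] (η : Measure Z) [IsProbabilityMeasure η] :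
    IsProbabilityMeasure (chainLaw κ η) := by
  unfold chainLaw; infer_instance

variable (κ : Kernel Z Z) [IsMarkovKernel κ] (η : Measure Z) [IsProbabilityMeasure η]

/-- The Markov property of the canonical chain. -/
theorem chainLaw_prefix_next {T : Type*} [MeasurableSpace T] (n : ℕ)
    {φ : ((i : Finset.Iic n) → Z) → T} (hφ : Measurable φ) {C : Set (T × Z)}
    (hC : MeasurableSet C) :
    chainLaw κ η {ω | (φ (Preorder.frestrictLe n ω), ω (n + 1)) ∈ C}
      = ∫⁻ ω, κ (ω n) {z | (φ (Preorder.frestrictLe n ω), z) ∈ C} ∂(chainLaw κ η) := by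
  have h := Kernel.map_frestrictLe_trajMeasure_compProd_eq_map_trajMeasure
    (X := fun _ => Z) (μ₀ := η) (a := n)
    (κ := fun n => κ.comap (fun h : (Finset.Iic n) → Z => h ⟨n, Finset.mem_Iic.2 le_rfl⟩)
      (measurable_pi_apply _))
  have hm : Measurable fun p : ((i : Finset.Iic n) → Z) × Z => (φ p.1, p.2) := by fun_prop
  have h2 := congrArg (fun m => m ((fun p : ((i : Finset.Iic n) → Z) × Z => (φ p.1, p.2)) ⁻¹' C)) h
  rw [Measure.map_apply (by fun_prop) (hm hC), Measure.compProd_apply (hm hC),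
    lintegral_map (Kernel.measurable_kernel_prodMk_left (hm hC)) (by fun_prop)] at h2
  exact h2.symm

theorem chainLaw_inter_next (n : ℕ) {S : Set (ℕ → Z)} (hS : MeasurableSet[pastField Z n] S)
    {B : Set Z} (hB : MeasurableSet B) :
    chainLaw κ η (S ∩ {ω | ω (n + 1) ∈ B}) = ∫⁻ ω in S, κ (ω n) B ∂(chainLaw κ η) := by
  have hS' := pastField_le n _ hS
  obtain ⟨D, hD, rfl⟩ := hS
  have h := chainLaw_prefix_next κ η n measurable_id (hD.prod hB)
  rw [← lintegral_indicator hS']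
  refine h.trans (lintegral_congr fun ω => ?_)
  by_cases hω : Preorder.frestrictLe n ω ∈ D <;> simp [hω]

theorem map_eval_zero_chainLaw : (chainLaw κ η).map (fun ω => ω 0) = η := by
  have h0 : (fun ω : ℕ → Z => ω 0)
      = (fun h : (Finset.Iic 0) → Z => h ⟨0, Finset.mem_Iic.2 le_rfl⟩) ∘
        Preorder.frestrictLe (π := fun _ => Z) 0 := rfl
  rw [h0, ← Measure.map_map (by fun_prop) (by fun_prop), chainLaw, Kernel.trajMeasure,
    Measure.map_comp _ _ (by fun_prop), Kernel.traj_map_frestrictLe, Kernel.partialTraj_self,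
    Measure.id_comp, Measure.map_map (by fun_prop) (by fun_prop)]
  exact Measure.map_id

end Chain

/-- The sequence of observations `Y_1, Y_2, …` of a trajectory. -/
def obsSeq {X Y : Type*} (ω : ℕ → X × Y) : ℕ → Y := fun i => (ω (i + 1)).2

/-- The observations `Y_{m+1}, Y_{m+2}, …`. -/
def obsTail {X Y : Type*} (m : ℕ) (ω : ℕ → X × Y) : ℕ → Y := fun i => (ω (m + i + 1)).2

/-- Concatenation of a finite word and of a sequence. -/
def glue {Y : Type*} (m : ℕ) (p : (Fin m → Y) × (ℕ → Y)) : ℕ → Y :=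
  fun i => if h : i < m then p.1 ⟨i, h⟩ else p.2 (i - m)

theorem glue_obs {X Y : Type*} (m : ℕ) (ω : ℕ → X × Y) :
    glue m (obs m ω, obsTail m ω) = obsSeq ω := by
  funext i
  by_cases h : i < m
  · simp [glue, h, obs, obsSeq]
  · simp [glue, h, obsTail, obsSeq, Nat.add_sub_cancel' (not_lt.1 h)]

section MeasurableObs

variable {X Y : Type*} [MeasurableSpace X] [MeasurableSpace Y]

@[fun_prop]
theorem measurable_obsSeq : Measurable (obsSeq : (ℕ → X × Y) → ℕ → Y) :=
  measurable_pi_iff.2 fun i => measurable_snd.comp (measurable_pi_apply (i + 1))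

@[fun_prop]
theorem measurable_obsTail (m : ℕ) : Measurable (obsTail m : (ℕ → X × Y) → ℕ → Y) :=
  measurable_pi_iff.2 fun i => measurable_snd.comp (measurable_pi_apply (m + i + 1))

theorem measurable_obs_pastField (m : ℕ) :
    Measurable[pastField (X × Y) m] (obs m : (ℕ → X × Y) → Fin m → Y) :=
  (@measurable_pi_iff _ _ _ (pastField (X × Y) m) _ _).2 fun i =>
    measurable_snd.comp (measurable_eval_pastField i.2)

@[fun_prop]
theorem measurable_obs (m : ℕ) : Measurable (obs m : (ℕ → X × Y) → Fin m → Y) :=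
  (measurable_obs_pastField m).mono (pastField_le m) le_rfl

@[fun_prop]
theorem measurable_glue (m : ℕ) : Measurable (glue (Y := Y) m) := by
  refine measurable_pi_iff.2 fun i => ?_
  by_cases h : i < m
  · simp only [glue, h, dite_true]; fun_prop
  · simp only [glue, h, dite_false]; fun_prop

end MeasurableObs

namespace FDPOMM

variable {Θ X Y : Type*} [MeasurableSpace Θ] [MeasurableSpace X] [MeasurableSpace Y]
  {μ : Measure X} {ν : Measure Y} [SigmaFinite μ] [SigmaFinite ν] {M : FDPOMM Θ X Y μ ν}

instance (M : FDPOMM Θ X Y μ ν) (θ : Θ) (η : Measure (X × Y)) [IsProbabilityMeasure η] :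
    IsProbabilityMeasure (M.law θ η) := by
  unfold law; infer_instance

namespace HMM

variable (H : M.HMM) (θ : Θ)

theorem QX_apply (x : X) : H.QX θ x = μ.withDensity (H.qX θ x) := by
  rw [QX, Kernel.withDensity_apply _ (H.measurable_qX θ), Kernel.const_apply]

theorem measurable_g_left (x : X) : Measurable (H.g θ x) :=
  (H.measurable_g θ).comp measurable_prodMk_left

theorem lintegral_Q {z : X × Y} {f : X × Y → ℝ≥0∞} (hf : Measurable f) :
    ∫⁻ z', f z' ∂(M.Q θ z) = ∫⁻ x, ∫⁻ y, H.g θ x y * f (x, y) ∂ν ∂(H.QX θ z.1) := by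
  have hqX : Measurable (H.qX θ z.1) := (H.measurable_qX θ).comp measurable_prodMk_left
  have hq : Measurable (M.q θ z) := M.measurable_q.comp (by fun_prop :
    Measurable fun z' : X × Y => (θ, z, z'))
  have hg : Measurable fun z' : X × Y => H.g θ z'.1 z'.2 := H.measurable_g θ
  rw [M.Q_apply, lintegral_withDensity_eq_lintegral_mul _ hq hf, QX_apply,
    lintegral_withDensity_eq_lintegral_mul _ hqX
      (Measurable.lintegral_prod_right' (f := fun z' : X × Y => H.g θ z'.1 z'.2 * f z')
        (hg.mul hf)),
    lintegral_prod _ (hq.mul hf).aemeasurable]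
  refine lintegral_congr fun x => ?_
  simp only [Pi.mul_apply, H.q_eq, mul_assoc]
  rw [lintegral_const_mul]
  exact (hg.mul hf).comp measurable_prodMk_left

theorem Q_prod (z : X × Y) {A : Set X} (hA : MeasurableSet A) {E : Set Y} (hE : MeasurableSet E) :
    M.Q θ z (A ×ˢ E) = ∫⁻ x in A, ν.withDensity (H.g θ x) E ∂(H.QX θ z.1) := by
  rw [← lintegral_indicator_one (hA.prod hE),
    H.lintegral_Q θ (measurable_one.indicator (hA.prod hE)), ← lintegral_indicator hA]
  refine lintegral_congr fun x => ?_
  by_cases hx : x ∈ A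
  · simp only [hx, Set.indicator_of_mem]
    rw [withDensity_apply _ hE, ← lintegral_indicator hE]
    refine lintegral_congr fun y => ?_
    by_cases hy : y ∈ E <;> simp [hx, hy]
  · simp [hx]

instance (x : X) : IsProbabilityMeasure (ν.withDensity (H.g θ x)) :=
  ⟨by simp [H.lintegral_g]⟩

theorem Q_fst (z : X × Y) {A : Set X} (hA : MeasurableSet A) :
    M.Q θ z (Prod.fst ⁻¹' A) = H.QX θ z.1 A := by
  rw [← Set.prod_univ, H.Q_prod θ z hA MeasurableSet.univ]
  simp

/-- The first marginal of `M.Q θ z` depends on `z` only through its hidden coordinate, so the hidden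
coordinate evolves as a Markov chain with kernel `H.QX θ`. -/
theorem map_hidden_law (η : Measure (X × Y)) [IsProbabilityMeasure η] (n : ℕ) :
    (M.law θ η).map (fun ω => (ω n).1) = η.fst.bind (H.QX θ ^ n) := by
  induction n with
  | zero =>
    have h : (fun ω : ℕ → X × Y => (ω 0).1) = Prod.fst ∘ fun ω => ω 0 := rfl
    rw [h, ← Measure.map_map (by fun_prop) (by fun_prop), law, map_eval_zero_chainLaw, pow_zero]
    exact Measure.bind_dirac.symm
  | succ n ih =>
    rw [pow_succ']
    change _ = η.fst.bind (H.QX θ ∘ₖ (H.QX θ ^ n))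
    rw [← Measure.comp_assoc, ← ih]
    ext A hA
    rw [Measure.map_apply (by fun_prop) hA, Measure.bind_apply hA (H.QX θ).aemeasurable,
      lintegral_map (Kernel.measurable_coe _ hA) (by fun_prop)]
    have h := chainLaw_inter_next (M.Q θ) η n MeasurableSet.univ (measurable_fst hA)
    rw [Set.univ_inter, Measure.restrict_univ] at h
    exact h.trans (lintegral_congr fun ω => H.Q_fst θ _ hA)

theorem invariant_fst {ρ : Measure (X × Y)} (hρ : (M.Q θ).Invariant ρ) :
    (H.QX θ).Invariant ρ.fst := by
  ext A hA
  rw [Measure.bind_apply hA (H.QX θ).aemeasurable, Measure.fst,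
    lintegral_map (Kernel.measurable_coe _ hA) measurable_fst, Measure.map_apply measurable_fst hA]
  nth_rw 2 [← hρ.def]
  rw [Measure.bind_apply (measurable_fst hA) (M.Q θ).aemeasurable]
  exact lintegral_congr fun z => (H.Q_fst θ z hA).symm

theorem invariant_pow {ρ : Measure X} (hρ : (H.QX θ).Invariant ρ) (n : ℕ) :
    (H.QX θ ^ n).Invariant ρ := by
  induction n with
  | zero => exact Measure.bind_dirac
  | succ n ih => rw [pow_succ]; exact ih.comp hρ

end HMM

end FDPOMM

end BayesPOMM

/-! ### The observations in the regime of constant emission. -/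

namespace BayesPOMM

namespace FDPOMM

variable {Θ X Y : Type*} [MeasurableSpace Θ] [MeasurableSpace X] [MeasurableSpace Y]
  {μ : Measure X} {ν : Measure Y} [SigmaFinite μ] [SigmaFinite ν] {M : FDPOMM Θ X Y μ ν}

namespace HMM

/-- Outside of a set `N` of hidden states, which is negligible for `ρ` and is never entered from
its complement, the emission density is the fixed density `gs`. -/
structure ConstEmission (H : M.HMM) (θ : Θ) (ρ : Measure X) (gs : Y → ℝ≥0∞) (N : Set X) :
    Prop where
  measurable_gs : Measurable gs
  gs_ne_zero : ∀ y, gs y ≠ 0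
  gs_ne_top : ∀ y, gs y ≠ ⊤
  isProb : IsProbabilityMeasure (ν.withDensity gs)
  measurableSet : MeasurableSet N
  null : ρ N = 0
  absorbing : ∀ x ∉ N, H.QX θ x N = 0
  emission : ∀ x ∉ N, H.g θ x =ᵐ[ν] gs

variable {H : M.HMM} {θ : Θ} {ρ : Measure X} {gs : Y → ℝ≥0∞} {N : Set X}

namespace ConstEmission

variable (C : H.ConstEmission θ ρ gs N)

include C

theorem Q_snd {z : X × Y} (hz : z.1 ∉ N) {E : Set Y} (hE : MeasurableSet E) :
    M.Q θ z (Prod.snd ⁻¹' E) = ν.withDensity gs E := by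
  rw [← Set.univ_prod, H.Q_prod θ z MeasurableSet.univ hE, Measure.restrict_univ]
  have h : ∀ᵐ x ∂(H.QX θ z.1), ν.withDensity (H.g θ x) E = ν.withDensity gs E := by
    have h0 : ∀ᵐ x ∂(H.QX θ z.1), x ∉ N := measure_eq_zero_iff_ae_notMem.1 (C.absorbing _ hz)
    filter_upwards [h0] with x hx
    rw [withDensity_congr_ae (C.emission x hx)]
  rw [lintegral_congr_ae h]
  simp

variable (η : Measure (X × Y)) [IsProbabilityMeasure η]

theorem measurableSet_hidden {i n : ℕ} (h : i ≤ n) :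
    MeasurableSet[pastField (X × Y) n] {ω : ℕ → X × Y | (ω i).1 ∉ N} :=
  (measurable_fst.comp (measurable_eval_pastField h)) C.measurableSet.compl

theorem law_hidden_mem (m k : ℕ) :
    M.law θ η {ω | (ω m).1 ∉ N ∧ (ω (m + k)).1 ∈ N} = 0 := by
  induction k with
  | zero => simp
  | succ k ih =>
    set S : Set (ℕ → X × Y) := {ω | (ω m).1 ∉ N} ∩ {ω | (ω (m + k)).1 ∉ N} with hS
    have hSm : MeasurableSet[pastField (X × Y) (m + k)] S :=
      MeasurableSet.inter (C.measurableSet_hidden (Nat.le_add_right m k))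
        (C.measurableSet_hidden le_rfl)
    have h1 : M.law θ η (S ∩ {ω | ω (m + k + 1) ∈ Prod.fst ⁻¹' N}) = 0 := by
      rw [law, chainLaw_inter_next _ _ _ hSm (measurable_fst C.measurableSet),
        setLIntegral_congr_fun (g := fun _ => 0) (pastField_le _ _ hSm)]
      · simp
      · intro ω hω
        simp only
        rw [H.Q_fst θ _ C.measurableSet]
        exact C.absorbing _ hω.2
    refine measure_mono_null ?_ (measure_union_null ih h1)
    rintro ω ⟨h2, h3⟩
    by_cases h4 : (ω (m + k)).1 ∈ N
    · exact Or.inl ⟨h2, h4⟩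
    · exact Or.inr ⟨⟨h2, h4⟩, h3⟩

/-- Off `N` the next observation has density `gs` whatever the hidden state, and by absorption the
chain remains off `N`; each further coordinate thus contributes an independent factor. -/
theorem law_inter_box {m : ℕ} {S : Set (ℕ → X × Y)} (hS : MeasurableSet[pastField (X × Y) m] S)
    (hSN : S ⊆ {ω | (ω m).1 ∉ N}) {E : ℕ → Set Y} (hE : ∀ i, MeasurableSet (E i)) (k : ℕ) :
    M.law θ η (S ∩ {ω | ∀ i < k, obsTail m ω i ∈ E i})
      = M.law θ η S * ∏ i ∈ Finset.range k, ν.withDensity gs (E i) := by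
  induction k with
  | zero => simp
  | succ k ih =>
    set S' := S ∩ {ω | ∀ i < k, obsTail m ω i ∈ E i} with hS'
    have hS'm : MeasurableSet[pastField (X × Y) (m + k)] S' := by
      refine MeasurableSet.inter (pastField_mono (Nat.le_add_right m k) _ hS) ?_
      have : {ω : ℕ → X × Y | ∀ i < k, obsTail m ω i ∈ E i}
          = ⋂ i, ⋂ (_ : i < k), {ω | (ω (m + i + 1)).2 ∈ E i} := by
        ext ω; simp [obsTail]
      rw [this]
      refine MeasurableSet.iInter fun i => MeasurableSet.iInter fun hi => ?_
      exact (measurable_snd.comp (measurable_eval_pastField (by omega))) (hE i)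
    have hset : S ∩ {ω | ∀ i < k + 1, obsTail m ω i ∈ E i}
        = S' ∩ {ω | ω (m + k + 1) ∈ Prod.snd ⁻¹' E k} := by
      ext ω
      simp only [hS', Set.mem_inter_iff, Set.mem_ofPred_eq, and_assoc, Nat.lt_succ_iff_lt_or_eq,
        or_imp, forall_and, forall_eq]
      rfl
    have hae : ∀ᵐ ω ∂(M.law θ η), ω ∈ S' →
        M.Q θ (ω (m + k)) (Prod.snd ⁻¹' E k) = ν.withDensity gs (E k) := by
      filter_upwards [measure_eq_zero_iff_ae_notMem.1 (C.law_hidden_mem η m k)] with ω hω hωS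
      exact C.Q_snd (fun h => hω ⟨hSN hωS.1, h⟩) (hE k)
    rw [hset, law, chainLaw_inter_next _ _ _ hS'm (measurable_snd (hE k)), ← law,
      setLIntegral_congr_fun_ae (pastField_le _ _ hS'm) hae, setLIntegral_const, ih,
      Finset.prod_range_succ]
    ring

/-- The law of the observations when the hidden chain is in the regime of constant emission. -/
theorem map_obsTail {m : ℕ} {S : Set (ℕ → X × Y)} (hS : MeasurableSet[pastField (X × Y) m] S)
    (hSN : S ⊆ {ω | (ω m).1 ∉ N}) :
    haveI := C.isProb
    ((M.law θ η).restrict S).map (obsTail m)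
      = M.law θ η S • Measure.infinitePi (fun _ : ℕ => ν.withDensity gs) := by
  have := C.isProb
  by_cases h0 : M.law θ η S = 0
  · rw [Measure.restrict_eq_zero.2 h0, h0]; simp
  have ht : M.law θ η S ≠ ⊤ := measure_ne_top _ _
  rw [← Measure.eq_infinitePi (μ := fun _ : ℕ => ν.withDensity gs)
    (ν := (M.law θ η S)⁻¹ • ((M.law θ η).restrict S).map (obsTail m)), smul_smul,
    ENNReal.mul_inv_cancel h0 ht, one_smul]
  intro s t ht'
  classical
  obtain ⟨k, hk⟩ : ∃ k, s ⊆ Finset.range k :=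
    ⟨s.sup id + 1, fun i hi => Finset.mem_range.2
      (Nat.lt_succ_of_le (Finset.le_sup (f := id) hi))⟩
  set E : ℕ → Set Y := fun i => if i ∈ s then t i else Set.univ with hEdef
  have hE : ∀ i, MeasurableSet (E i) := fun i => by
    by_cases hi : i ∈ s <;> simp [hEdef, hi, ht']
  have hpi : MeasurableSet ((s : Set ℕ).pi t) :=
    MeasurableSet.pi (Finset.countable_toSet s) fun i _ => ht' i
  have hpre : obsTail m ⁻¹' ((s : Set ℕ).pi t) ∩ S
      = S ∩ {ω : ℕ → X × Y | ∀ i < k, obsTail m ω i ∈ E i} := by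
    ext ω
    simp only [Set.mem_inter_iff, Set.mem_preimage, Set.mem_pi, Finset.mem_coe, Set.mem_ofPred_eq]
    rw [and_comm]
    refine and_congr_right fun _ => ⟨fun h i _ => ?_, fun h i hi => ?_⟩
    · by_cases hi : i ∈ s
      · simpa [hEdef, hi] using h i hi
      · simp [hEdef, hi]
    · simpa [hEdef, hi] using h i (Finset.mem_range.1 (hk hi))
  rw [Measure.smul_apply, Measure.map_apply (by fun_prop) hpi,
    Measure.restrict_apply ((measurable_obsTail m) hpi), hpre, C.law_inter_box η hS hSN hE k,
    smul_eq_mul, ← mul_assoc, ENNReal.inv_mul_cancel h0 ht, one_mul]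
  rw [← Finset.prod_subset hk]
  · exact Finset.prod_congr rfl fun i hi => by simp [hEdef, hi]
  · intro i _ hi
    simp [hEdef, hi, this.measure_univ]

/-- Independence of past and future observations: `map_obsTail` holds on every event of the past
contained in `{X_m ∉ N}`, in particular on those determined by the first `m` observations. -/
theorem map_obs_obsTail (m : ℕ) :
    haveI := C.isProb
    ((M.law θ η).restrict {ω | (ω m).1 ∉ N}).map (fun ω => (obs m ω, obsTail m ω))
      = (((M.law θ η).restrict {ω | (ω m).1 ∉ N}).map (obs m)).prod
          (Measure.infinitePi (fun _ : ℕ => ν.withDensity gs)) := by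
  have := C.isProb
  symm
  refine Measure.prod_eq fun A B hA hB => ?_
  have hA' : MeasurableSet[pastField (X × Y) m] (obs m ⁻¹' A : Set (ℕ → X × Y)) :=
    (measurable_obs_pastField m) hA
  have hS := MeasurableSet.inter hA' (C.measurableSet_hidden (n := m) le_rfl)
  have h := congrArg (fun r => r B) (C.map_obsTail η hS Set.inter_subset_right)
  simp only [Measure.smul_apply, smul_eq_mul] at h
  rw [Measure.map_apply (by fun_prop) hB,
    Measure.restrict_apply ((measurable_obsTail m) hB)] at h
  rw [Measure.map_apply (by fun_prop) (hA.prod hB), Measure.map_apply (by fun_prop) hA,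
    Measure.restrict_apply (pastField_le _ _ hA'),
    Measure.restrict_apply ((by fun_prop : Measurable fun ω : ℕ → X × Y =>
      (obs m ω, obsTail m ω)) (hA.prod hB)), ← h]
  congr 1
  ext ω
  simp only [Set.mem_inter_iff, Set.mem_preimage, Set.mem_prod]
  tauto

theorem ae_hidden_notMem (hη : η.fst = ρ) (m : ℕ) : ∀ᵐ ω ∂(M.law θ η), (ω m).1 ∉ N := by
  have h0 : M.law θ η {ω | (ω 0).1 ∈ N} = 0 := by
    have h := H.map_hidden_law θ η 0
    rw [pow_zero] at h
    have h2 : (M.law θ η).map (fun ω => (ω 0).1) = ρ := by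
      rw [h, ← hη]; exact Measure.bind_dirac
    have h3 := C.null
    rwa [← h2, Measure.map_apply (by fun_prop) C.measurableSet] at h3
  have h1 := C.law_hidden_mem η 0 m
  rw [zero_add] at h1
  filter_upwards [measure_eq_zero_iff_ae_notMem.1 h0, measure_eq_zero_iff_ae_notMem.1 h1]
    with ω a b c
  exact b ⟨a, c⟩

theorem restrict_hidden (hη : η.fst = ρ) (m : ℕ) :
    (M.law θ η).restrict {ω | (ω m).1 ∉ N} = M.law θ η :=
  Measure.restrict_eq_self_of_ae_mem (C.ae_hidden_notMem η hη m)

theorem map_obsSeq (hη : η.fst = ρ) :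
    haveI := C.isProb
    (M.law θ η).map obsSeq = Measure.infinitePi (fun _ : ℕ => ν.withDensity gs) := by
  have := C.isProb
  have h := C.map_obsTail η (m := 0) (C.measurableSet_hidden le_rfl) (subset_refl _)
  rw [C.restrict_hidden η hη 0] at h
  have h1 : M.law θ η {ω | (ω 0).1 ∉ N} = 1 := by
    rw [← Measure.restrict_apply_univ, C.restrict_hidden η hη 0, measure_univ]
  have h2 : (obsTail 0 : (ℕ → X × Y) → ℕ → Y) = obsSeq := by
    funext ω i; simp [obsTail, obsSeq]
  rwa [h1, one_smul, h2] at h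

/-- Under `π` the next observation has density `gs`, which never vanishes, so a null event has
`ν`-null sections. Under any initial law the next observation is absolutely continuous with respect
to `ν`, so these sections are also null for it. -/
theorem map_obs_absolutelyContinuous (π : Measure (X × Y)) [IsProbabilityMeasure π]
    (hπ : π.fst = ρ) (m : ℕ) :
    (M.law θ η).map (obs m) ≪ (M.law θ π).map (obs m) := by
  induction m with
  | zero =>
    refine Measure.AbsolutelyContinuous.mk fun s hs h => ?_
    rcases Set.eq_empty_or_nonempty s with rfl | ⟨a, ha⟩
    · simp
    · have hu : s = Set.univ := Set.eq_univ_of_forall fun b => Subsingleton.elim a b ▸ ha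
      rw [hu, Measure.map_apply (by fun_prop) MeasurableSet.univ, Set.preimage_univ,
        measure_univ] at h
      simp at h
  | succ m ih =>
    refine Measure.AbsolutelyContinuous.mk fun s hs h => ?_
    let φ : ((i : Finset.Iic m) → X × Y) → Fin m → Y :=
      fun h i => (h ⟨i + 1, Finset.mem_Iic.2 i.2⟩).2
    have hφ : Measurable φ := by fun_prop
    have hsnoc : Measurable fun p : (Fin m → Y) × (X × Y) => (Fin.snoc p.1 p.2.2 : Fin (m+1) → Y) := by
      refine measurable_pi_iff.2 fun i => ?_
      refine Fin.lastCases ?_ (fun i => ?_) i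
      · simp only [Fin.snoc_last]; fun_prop
      · simp only [Fin.snoc_castSucc]; fun_prop
    have hsnocY : Measurable fun p : (Fin m → Y) × Y => (Fin.snoc p.1 p.2 : Fin (m+1) → Y) := by
      refine measurable_pi_iff.2 fun i => ?_
      refine Fin.lastCases ?_ (fun i => ?_) i
      · simp only [Fin.snoc_last]; fun_prop
      · simp only [Fin.snoc_castSucc]; fun_prop
    have hobs : ∀ ω : ℕ → X × Y, obs (m + 1) ω
        = Fin.snoc (φ (Preorder.frestrictLe m ω)) (ω (m + 1)).2 := by
      intro ω
      funext i
      refine Fin.lastCases ?_ (fun i => ?_) i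
      · simp [obs]
      · simp [obs, φ]
    have hφobs : ∀ ω : ℕ → X × Y, φ (Preorder.frestrictLe m ω) = obs m ω := fun ω => rfl
    have key : ∀ (ξ : Measure (X × Y)) [IsProbabilityMeasure ξ],
        (M.law θ ξ).map (obs (m + 1)) s
          = ∫⁻ ω, M.Q θ (ω m) (Prod.snd ⁻¹' {y | Fin.snoc (obs m ω) y ∈ s}) ∂(M.law θ ξ) := by
      intro ξ _
      rw [Measure.map_apply (by fun_prop) hs]
      have := chainLaw_prefix_next (M.Q θ) ξ m hφ (hsnoc hs)
      refine Eq.trans ?_ this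
      rw [law]
      congr 1
      ext ω
      simp [hobs]
    have hsec : ∀ h : Fin m → Y, MeasurableSet {y | (Fin.snoc h y : Fin (m+1) → Y) ∈ s} := fun h =>
      (hsnocY.comp measurable_prodMk_left) hs
    have hmeas : Measurable fun h : Fin m → Y =>
        ν.withDensity gs {y | (Fin.snoc h y : Fin (m+1) → Y) ∈ s} :=
      have := C.isProb
      measurable_measure_prodMk_left (hsnocY hs)
    rw [key π] at h
    have h1 : ∫⁻ ω, ν.withDensity gs {y | (Fin.snoc (obs m ω) y : Fin (m+1) → Y) ∈ s}
        ∂(M.law θ π) = 0 := by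
      rw [← h]
      refine lintegral_congr_ae ?_
      filter_upwards [C.ae_hidden_notMem π hπ m] with ω hω
      exact (C.Q_snd hω (hsec _)).symm
    rw [← lintegral_map hmeas (measurable_obs m), lintegral_eq_zero_iff hmeas] at h1
    have h2 := ih.ae_le h1
    have h3 : ∀ᵐ ω ∂(M.law θ η), ν.withDensity gs {y | (Fin.snoc (obs m ω) y : Fin (m+1) → Y) ∈ s} = 0 :=
      ae_of_ae_map (by fun_prop) h2
    rw [key η, lintegral_eq_zero_iff']
    · filter_upwards [h3] with ω hω
      rw [withDensity_apply_eq_zero C.measurable_gs] at hω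
      have hω' : ν {y | (Fin.snoc (obs m ω) y : Fin (m+1) → Y) ∈ s} = 0 := by
        simpa [C.gs_ne_zero] using hω
      rw [← Set.univ_prod, H.Q_prod θ _ MeasurableSet.univ (hsec _)]
      simp only [Pi.zero_apply]
      refine (lintegral_congr fun x => ?_).trans lintegral_zero
      exact withDensity_absolutelyContinuous _ _ hω'
    · refine Measurable.aemeasurable ?_
      have hm : Measurable fun p : (ℕ → X × Y) × (X × Y) =>
          (Fin.snoc (obs m p.1) p.2.2 : Fin (m + 1) → Y) :=
        hsnoc.comp (by fun_prop : Measurable fun p : (ℕ → X × Y) × (X × Y) => (obs m p.1, p.2))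
      exact Kernel.measurable_kernel_prodMk_left (κ := (M.Q θ).comap (fun ω : ℕ → X × Y => ω m)
        (measurable_pi_apply m)) (hm hs)

/-- Whatever the initial distribution, the law of the observations is absolutely continuous with
respect to their stationary law, if the hidden chain eventually leaves `N`. -/
theorem map_obsSeq_absolutelyContinuous (π : Measure (X × Y)) [IsProbabilityMeasure π]
    (hπ : π.fst = ρ)
    (hN : Tendsto (fun n : ℕ => (η.fst.bind (H.QX θ ^ n)) N) atTop (𝓝 0)) :
    (M.law θ η).map obsSeq ≪ (M.law θ π).map obsSeq := by
  refine Measure.AbsolutelyContinuous.mk fun s hs h => ?_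
  rw [Measure.map_apply measurable_obsSeq hs] at h ⊢
  -- It suffices to bound the probability, for each `m`, by that of `X_m ∈ N`. On the complementary
  -- event the past and the tail of the observations are independent, the tail has the same law as
  -- under `π`, and the past is absolutely continuous.
  refine le_antisymm (ge_of_tendsto' hN fun m => ?_) zero_le
  rw [← H.map_hidden_law θ η m, Measure.map_apply (by fun_prop) C.measurableSet]
  have := C.isProb
  have hac : ((M.law θ η).restrict {ω | (ω m).1 ∉ N}).map (obs m)
      ≪ ((M.law θ π).restrict {ω | (ω m).1 ∉ N}).map (obs m) := by
    rw [C.restrict_hidden π hπ m]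
    exact (Measure.restrict_le_self.absolutelyContinuous.map (by fun_prop)).trans
      (C.map_obs_absolutelyContinuous η π hπ m)
  have hac2 := hac.prod (Measure.AbsolutelyContinuous.refl
    (Measure.infinitePi (fun _ : ℕ => ν.withDensity gs)))
  rw [← C.map_obs_obsTail η m, ← C.map_obs_obsTail π m, C.restrict_hidden π hπ m] at hac2
  have hpre : ∀ ω : ℕ → X × Y, (obs m ω, obsTail m ω) ∈ glue m ⁻¹' s ↔ ω ∈ obsSeq ⁻¹' s := by
    intro ω; rw [Set.mem_preimage, glue_obs, Set.mem_preimage]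
  have h0 : (M.law θ π).map (fun ω => (obs m ω, obsTail m ω)) (glue m ⁻¹' s) = 0 := by
    rw [Measure.map_apply (by fun_prop) (measurable_glue m hs)]
    refine Eq.trans (congrArg _ ?_) h
    ext ω; exact hpre ω
  have h1 := hac2 h0
  rw [Measure.map_apply (by fun_prop) (measurable_glue m hs), Measure.restrict_apply
    ((by fun_prop : Measurable fun ω : ℕ → X × Y => (obs m ω, obsTail m ω))
      (measurable_glue m hs))] at h1
  refine (measure_le_inter_add_sdiff _ _ {ω : ℕ → X × Y | (ω m).1 ∉ N}).trans ?_
  have h2 : M.law θ η (obsSeq ⁻¹' s ∩ {ω | (ω m).1 ∉ N}) = 0 := by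
    refine Eq.trans (congrArg _ ?_) h1
    ext ω
    exact and_congr_left fun _ => (hpre ω).symm
  rw [h2, zero_add]
  refine measure_mono fun ω hω => ?_
  simpa using hω.2

end ConstEmission

end HMM

end FDPOMM

end BayesPOMM

/-! ### Lower bounds for the likelihood along a fixed sequence of observations. -/

namespace BayesPOMM

/-- The singular part of `ρ` lives on a `K`-null set, of `ρ`-mass at most `1/4`. The remaining mass
exceeds `1/2` and has a density with respect to `K`; truncating this density at a high level keeps
mass at least `1/2`. -/
theorem exists_restrict_le_smul {α : Type*} [MeasurableSpace α] (ρ K : Measure α)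
    [IsProbabilityMeasure ρ] [IsFiniteMeasure K]
    (h : ∀ S, MeasurableSet S → K S = 0 → ρ S ≤ 4⁻¹) :
    ∃ A, 2⁻¹ ≤ ρ A ∧ ∃ c : ℝ≥0∞, c ≠ 0 ∧ c ≠ ⊤ ∧ ρ.restrict A ≤ c • K := by
  have hms := Measure.mutuallySingular_singularPart ρ K
  set S := hms.nullSet with hS
  have hSm : MeasurableSet S := hms.measurableSet_nullSet
  set f := ρ.rnDeriv K with hf
  have hfm : Measurable f := Measure.measurable_rnDeriv _ _
  have hρ : ∀ B ⊆ S, ρ B = K.withDensity f B := by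
    intro B hB
    conv_lhs => rw [ρ.haveLebesgueDecomposition_add K]
    rw [Measure.add_apply, measure_mono_null hB hms.measure_nullSet, zero_add]
  have hSc : ρ Sᶜ ≤ 4⁻¹ := h _ hSm.compl hms.measure_compl_nullSet
  have hS1 : 2⁻¹ < ρ S := by
    by_contra hlt
    have h1 : (1 : ℝ≥0∞) ≤ 2⁻¹ + 4⁻¹ := by
      rw [← measure_univ (μ := ρ), ← measure_add_measure_compl hSm]
      exact add_le_add (not_lt.1 hlt) hSc
    have h2 := (ENNReal.toReal_le_toReal (by simp) (by simp)).2 h1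
    rw [ENNReal.toReal_add (by simp) (by simp)] at h2
    norm_num at h2
  set A : ℕ → Set α := fun n => S ∩ {x | f x ≤ n} with hA
  have hAm : ∀ n, MeasurableSet (A n) := fun n => hSm.inter (measurableSet_le hfm measurable_const)
  have hmono : Monotone A := by
    intro n m hnm x hx
    exact ⟨hx.1, le_trans (show f x ≤ n from hx.2) (by exact_mod_cast hnm)⟩
  have hU : ρ (⋃ n, A n) = ρ S := by
    refine measure_eq_measure_of_null_sdiff (Set.iUnion_subset fun n => Set.inter_subset_left) ?_
    rw [hρ _ Set.sdiff_subset]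
    refine withDensity_absolutelyContinuous _ _ ?_
    refine measure_mono_null (t := {x | ¬ f x < ⊤}) ?_ (Measure.rnDeriv_lt_top ρ K)
    rintro x ⟨hxS, hx⟩ hlt
    obtain ⟨n, hn⟩ := ENNReal.exists_nat_gt hlt.ne
    exact hx (Set.mem_iUnion.2 ⟨n, hxS, hn.le⟩)
  have ht := tendsto_measure_iUnion_atTop (μ := ρ) hmono
  rw [hU] at ht
  obtain ⟨n, hn⟩ := (ht.eventually (lt_mem_nhds hS1)).exists
  -- The constant is `n + 1` and not `n`, so that it is nonzero.
  refine ⟨A n, hn.le, n + 1, by simp, by finiteness, ?_⟩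
  refine Measure.le_intro fun B hB _ => ?_
  rw [Measure.restrict_apply hB, hρ _ (Set.inter_subset_right.trans Set.inter_subset_left),
    withDensity_apply _ (hB.inter (hAm n)), Measure.smul_apply, smul_eq_mul]
  calc ∫⁻ x in B ∩ A n, f x ∂K ≤ ∫⁻ _ in B ∩ A n, (n : ℝ≥0∞) ∂K :=
        setLIntegral_mono measurable_const fun x hx => hx.2.2
    _ = n * K (B ∩ A n) := setLIntegral_const _ _
    _ ≤ (n + 1) * K B := by gcongr; exacts [le_self_add, Set.inter_subset_left]

namespace FDPOMM

variable {Θ X Y : Type*} [MeasurableSpace Θ] [MeasurableSpace X] [MeasurableSpace Y]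
  {μ : Measure X} {ν : Measure Y} [SigmaFinite μ] [SigmaFinite ν] {M : FDPOMM Θ X Y μ ν}

namespace HMM

variable (H : M.HMM) (θ : Θ)

/-- The likelihood of the first `n` observations given the initial hidden state. -/
noncomputable def condLik : ℕ → X → (ℕ → Y) → ℝ≥0∞
  | 0, _, _ => 1
  | n + 1, x, y => ∫⁻ x', H.g θ x' (y 0) * condLik n x' (fun i => y (i + 1)) ∂(H.QX θ x)

/-- The unnormalised filter: the joint measure of the first `n` observations and of the hidden
state at time `n`. -/
noncomputable def filterMeasure : ℕ → Measure X → (ℕ → Y) → Measure X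
  | 0, κ, _ => κ
  | n + 1, κ, y => filterMeasure n ((κ.bind (H.QX θ)).withDensity fun x => H.g θ x (y 0))
      (fun i => y (i + 1))

/-- The pointwise cost `log⁺ (gs y / g x y)`. -/
noncomputable def cost (gs : Y → ℝ≥0∞) (x : X) (y : Y) : ℝ≥0∞ := logPlus (gs y / H.g θ x y)

/-- The expected cumulative cost of the first `n` observations given the initial hidden state. -/
noncomputable def cumCost (gs : Y → ℝ≥0∞) : ℕ → X → (ℕ → Y) → ℝ≥0∞
  | 0, _, _ => 0
  | n + 1, x, y => ∫⁻ x', (H.cost θ gs x' (y 0) + cumCost gs n x' (fun i => y (i + 1)))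
      ∂(H.QX θ x)

theorem measurable_condLik (n : ℕ) :
    Measurable fun p : X × (ℕ → Y) => H.condLik θ n p.1 p.2 := by
  induction n with
  | zero => exact measurable_const
  | succ n ih =>
    have h : Measurable fun p : (X × (ℕ → Y)) × X =>
        H.g θ p.2 (p.1.2 0) * H.condLik θ n p.2 (fun i => p.1.2 (i + 1)) :=
      ((H.measurable_g θ).comp (by fun_prop : Measurable fun p : (X × (ℕ → Y)) × X =>
        (p.2, p.1.2 0))).mul (ih.comp (by fun_prop : Measurable fun p : (X × (ℕ → Y)) × X =>
        (p.2, fun i => p.1.2 (i + 1))))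
    exact Measurable.lintegral_kernel_prod_right' (κ := (H.QX θ).comap Prod.fst measurable_fst) h

theorem measurable_condLik_left (n : ℕ) (y : ℕ → Y) : Measurable fun x => H.condLik θ n x y :=
  (H.measurable_condLik θ n).comp (by fun_prop : Measurable fun x : X => (x, y))

theorem measurable_g_right (y : Y) : Measurable fun x => H.g θ x y :=
  (H.measurable_g θ).comp (by fun_prop : Measurable fun x : X => (x, y))

theorem measurable_cost {gs : Y → ℝ≥0∞} (hgs : Measurable gs) :
    Measurable fun p : X × Y => H.cost θ gs p.1 p.2 :=
  measurable_logPlus.comp ((hgs.comp measurable_snd).div (H.measurable_g θ))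

theorem measurable_cost_left (gs : Y → ℝ≥0∞) (y : Y) : Measurable fun x => H.cost θ gs x y :=
  measurable_logPlus.comp (measurable_const.div (H.measurable_g_right θ y))

theorem measurable_cumCost_left (gs : Y → ℝ≥0∞) (n : ℕ) (y : ℕ → Y) :
    Measurable fun x => H.cumCost θ gs n x y := by
  induction n generalizing y with
  | zero => exact measurable_const
  | succ n ih =>
    exact Measurable.lintegral_kernel ((H.measurable_cost_left θ gs (y 0)).add (ih _))

theorem lintegral_QX (x : X) {f : X → ℝ≥0∞} (hf : Measurable f) :
    ∫⁻ x', f x' ∂(H.QX θ x) = ∫⁻ x', H.qX θ x x' * f x' ∂μ := by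
  have hq : Measurable (H.qX θ x) := (H.measurable_qX θ).comp measurable_prodMk_left
  rw [QX_apply, lintegral_withDensity_eq_lintegral_mul _ hq hf]
  rfl

/-- Integrating out the first hidden state leaves the same integral for a path started at `(a, y
0)`, which is the recursion of `condLik`. -/
theorem lintegral_prod_q (n : ℕ) (z₀ : X × Y) (y : ℕ → Y) :
    ∫⁻ x : Fin n → X,
      (let z : Fin (n + 1) → X × Y := Fin.cons z₀ (fun i => (x i, y i))
       ∏ i : Fin n, M.q θ (z i.castSucc) (z i.succ)) ∂(Measure.pi fun _ => μ)
      = H.condLik θ n z₀.1 y := by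
  induction n generalizing z₀ y with
  | zero => simp [condLik]
  | succ n ih =>
    have hmp := (measurePreserving_piFinSuccAbove (fun _ : Fin (n + 1) => μ) 0).symm
    rw [← hmp.lintegral_comp_emb (MeasurableEquiv.measurableEmbedding _)]
    have hm : ∀ {k : ℕ} (w : X × Y) (u : Fin k → Y), Measurable fun x : Fin k → X =>
        (let z : Fin (k + 1) → X × Y := Fin.cons w (fun i => (x i, u i))
         ∏ i : Fin k, M.q θ (z i.castSucc) (z i.succ)) := by
      intro k w u
      have hz : Measurable fun x : Fin k → X =>
          (Fin.cons w (fun i => (x i, u i)) : Fin (k + 1) → X × Y) := by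
        refine measurable_pi_iff.2 fun i => ?_
        refine Fin.cases ?_ (fun i => ?_) i
        · simp only [Fin.cons_zero]; fun_prop
        · simp only [Fin.cons_succ]; fun_prop
      refine Finset.measurable_prod _ fun i _ => ?_
      have hz2 : Measurable fun x : Fin k → X =>
          (θ, (Fin.cons w (fun i => (x i, u i)) : Fin (k + 1) → X × Y) i.castSucc,
            (Fin.cons w (fun i => (x i, u i)) : Fin (k + 1) → X × Y) i.succ) :=
        measurable_const.prodMk (((measurable_pi_apply _).comp hz).prodMk
          ((measurable_pi_apply _).comp hz))
      exact M.measurable_q.comp hz2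
    refine (lintegral_prod _ ((hm z₀ fun i : Fin (n + 1) => y i).comp
      (MeasurableEquiv.piFinSuccAbove (fun _ : Fin (n + 1) => X) 0).symm.measurable).aemeasurable).trans
      ?_
    have hstep : ∀ a : X, ∫⁻ x : Fin n → X,
        (let z : Fin (n + 2) → X × Y := Fin.cons z₀ (fun i =>
          ((MeasurableEquiv.piFinSuccAbove (fun _ : Fin (n + 1) => X) 0).symm (a, x) i, y i))
         ∏ i : Fin (n + 1), M.q θ (z i.castSucc) (z i.succ)) ∂(Measure.pi fun _ => μ)
        = H.qX θ z₀.1 a * (H.g θ a (y 0) * H.condLik θ n a (fun i => y (i + 1))) := by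
      intro a
      rw [← ih (a, y 0) (fun i => y (i + 1)), ← mul_assoc, ← lintegral_const_mul _ (hm _ _)]
      refine lintegral_congr fun x => ?_
      have hx : ∀ i, (MeasurableEquiv.piFinSuccAbove (fun _ : Fin (n + 1) => X) 0).symm (a, x) i
          = (Fin.cons a x : Fin (n + 1) → X) i := fun i => by
        change (Fin.insertNth (α := fun _ : Fin (n + 1) => X) 0 a x) i = _
        rw [Fin.insertNth_zero]
        rfl
      simp only [hx]
      rw [Fin.prod_univ_succ]
      congr 1
      · simp only [Fin.castSucc_zero, Fin.cons_zero, Fin.succ_zero_eq_one]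
        rw [show (1 : Fin (n + 2)) = Fin.succ 0 from rfl, Fin.cons_succ, Fin.cons_zero, H.q_eq]
        rfl
      · have hz : ∀ i : Fin (n + 1), ((Fin.cons a x : Fin (n + 1) → X) i, y i)
            = (Fin.cons (a, y 0) (fun i : Fin n => (x i, y (i + 1))) : Fin (n + 1) → X × Y) i := by
          intro i
          refine Fin.cases ?_ (fun i => ?_) i <;> simp
        refine Finset.prod_congr rfl fun i _ => ?_
        rw [← Fin.succ_castSucc, Fin.cons_succ, Fin.cons_succ, hz, hz]
    refine (lintegral_congr hstep).trans ?_
    rw [condLik, H.lintegral_QX]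
    exact (H.measurable_g_right θ _).mul (H.measurable_condLik_left θ n _)

theorem likelihood_eq (η : Measure (X × Y)) (n : ℕ) (y : ℕ → Y) :
    M.likelihood θ η (fun i : Fin n => y i) = ∫⁻ x, H.condLik θ n x y ∂η.fst := by
  rw [Measure.fst, lintegral_map (H.measurable_condLik_left θ n y) measurable_fst]
  exact lintegral_congr fun z => H.lintegral_prod_q θ n z y

theorem lintegral_filterMeasure (m k : ℕ) (κ : Measure X) (y : ℕ → Y) :
    ∫⁻ x, H.condLik θ (m + k) x y ∂κ
      = ∫⁻ x, H.condLik θ k x (fun i => y (m + i)) ∂(H.filterMeasure θ m κ y) := by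
  induction m generalizing κ y with
  | zero => simp [filterMeasure]
  | succ m ih =>
    have hg := H.measurable_g_right θ (y 0)
    have hL := H.measurable_condLik_left θ (m + k) (fun i => y (i + 1))
    rw [filterMeasure]
    have h1 : (fun i => y (m + 1 + i)) = fun i => (fun i => y (i + 1)) (m + i) := by
      funext i; simp only; congr 1; omega
    rw [h1, ← ih, lintegral_withDensity_eq_lintegral_mul _ hg hL,
      Measure.lintegral_bind (H.QX θ).aemeasurable (hg.mul hL).aemeasurable,
      show m + 1 + k = m + k + 1 by omega]
    rfl

theorem filterMeasure_univ (m : ℕ) (κ : Measure X) (y : ℕ → Y) :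
    H.filterMeasure θ m κ y Set.univ = ∫⁻ x, H.condLik θ m x y ∂κ := by
  have h := H.lintegral_filterMeasure θ m 0 κ y
  simpa [condLik] using h.symm

theorem bind_QX_absolutelyContinuous (κ : Measure X) : κ.bind (H.QX θ) ≪ μ := by
  refine Measure.AbsolutelyContinuous.mk fun s hs h => ?_
  rw [Measure.bind_apply hs (H.QX θ).aemeasurable]
  refine (lintegral_congr fun x => ?_).trans lintegral_zero
  rw [QX_apply]
  exact withDensity_absolutelyContinuous _ _ h

/-- Each observation reweights the predicted hidden law by `g`. This law is absolutely continuous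
with respect to `μ`, and `g` is `μ`-almost everywhere nonzero at the observed value, so the
reweighting creates no new null set. -/
theorem bind_pow_absolutelyContinuous {y : ℕ → Y} (hy : ∀ i, ∀ᵐ x ∂μ, H.g θ x (y i) ≠ 0)
    (m : ℕ) (κ : Measure X) : κ.bind (H.QX θ ^ m) ≪ H.filterMeasure θ m κ y := by
  induction m generalizing κ y with
  | zero =>
    rw [pow_zero, filterMeasure]
    exact Measure.absolutelyContinuous_of_eq Measure.bind_dirac
  | succ m ih =>
    rw [pow_succ, filterMeasure]
    change κ.bind ((H.QX θ ^ m) ∘ₖ H.QX θ) ≪ _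
    rw [← Measure.comp_assoc]
    refine Measure.AbsolutelyContinuous.trans ?_ (ih (fun i => hy (i + 1)) _)
    refine Measure.AbsolutelyContinuous.comp_right ?_ _
    exact withDensity_absolutelyContinuous' (H.measurable_g_right θ _).aemeasurable
      ((H.bind_QX_absolutelyContinuous θ κ).ae_le (hy 0))

/-- Jensen's inequality is applied to each transition of the hidden chain, and
`mul_negExp_logPlus_le` to each emission factor. -/
theorem prod_mul_negExp_le {gs : Y → ℝ≥0∞} (hgs : ∀ y, gs y ≠ ⊤) (n : ℕ) (x : X) (y : ℕ → Y) :
    (∏ i ∈ Finset.range n, gs (y i)) * negExp (H.cumCost θ gs n x y) ≤ H.condLik θ n x y := by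
  induction n generalizing x y with
  | zero => simp [cumCost, condLik]
  | succ n ih =>
    have hm := (H.measurable_cost_left θ gs (y 0)).add
      (H.measurable_cumCost_left θ gs n (fun i => y (i + 1)))
    rw [Finset.prod_range_succ', condLik, cumCost]
    calc _ ≤ ((∏ i ∈ Finset.range n, gs (y (i + 1))) * gs (y 0)) *
          ∫⁻ x', negExp (H.cost θ gs x' (y 0) + H.cumCost θ gs n x' (fun i => y (i + 1)))
            ∂(H.QX θ x) := by
          gcongr
          exact negExp_lintegral_le _ hm
      _ = ∫⁻ x', ((∏ i ∈ Finset.range n, gs (y (i + 1))) * gs (y 0)) *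
          negExp (H.cost θ gs x' (y 0) + H.cumCost θ gs n x' (fun i => y (i + 1)))
            ∂(H.QX θ x) := (lintegral_const_mul _ (measurable_negExp.comp hm)).symm
      _ ≤ _ := by
        refine lintegral_mono fun x' => ?_
        simp only
        rw [negExp_add]
        calc _ = (gs (y 0) * negExp (H.cost θ gs x' (y 0))) *
              ((∏ i ∈ Finset.range n, gs (y (i + 1))) *
                negExp (H.cumCost θ gs n x' (fun i => y (i + 1)))) := by ring
          _ ≤ _ := mul_le_mul' (mul_negExp_logPlus_le (hgs _) _) (ih x' _)

/-- Started from the invariant law, the hidden state has law `ρ` at every time, so the cumulative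
cost becomes additive in the observations. -/
theorem lintegral_cumCost {ρ : Measure X} (hρ : (H.QX θ).Invariant ρ) (gs : Y → ℝ≥0∞) (n : ℕ)
    (y : ℕ → Y) :
    ∫⁻ x, H.cumCost θ gs n x y ∂ρ
      = ∑ i ∈ Finset.range n, ∫⁻ x, H.cost θ gs x (y i) ∂ρ := by
  induction n generalizing y with
  | zero => simp [cumCost]
  | succ n ih =>
    have hm1 := H.measurable_cost_left θ gs (y 0)
    have hm2 := H.measurable_cumCost_left θ gs n (fun i => y (i + 1))
    have h := Measure.lintegral_bind (m := ρ) (H.QX θ).aemeasurable (hm1.add hm2).aemeasurable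
    rw [hρ.def] at h
    rw [Finset.sum_range_succ', ← ih, ← lintegral_add_right _ hm1]
    simp_rw [add_comm (H.cumCost θ gs n _ _)]
    exact h.symm

/-- The likelihood started from an arbitrary initial distribution `κ` is bounded from below by the
likelihood of a sequence with density `gs`, up to the exponential of the cumulative cost under the
stationary distribution. -/
theorem exists_mul_le_lintegral_condLik {ρ : Measure X} [IsProbabilityMeasure ρ]
    (hρ : (H.QX θ).Invariant ρ) {gs : Y → ℝ≥0∞} (hgs : ∀ y, gs y ≠ ⊤) {κ : Measure X} {m : ℕ}
    (hκ : ∀ S, MeasurableSet S → (κ.bind (H.QX θ ^ m)) S = 0 → ρ S ≤ 4⁻¹) {y : ℕ → Y}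
    (hy : ∀ i, ∀ᵐ x ∂μ, H.g θ x (y i) ≠ 0) (hfin : ∫⁻ x, H.condLik θ m x y ∂κ ≠ ⊤) :
    ∃ c : ℝ≥0∞, c ≠ 0 ∧ ∀ k, c * (∏ i ∈ Finset.range k, gs (y (m + i))) *
        negExp (2 * ∑ i ∈ Finset.range k, ∫⁻ x, H.cost θ gs x (y (m + i)) ∂ρ)
      ≤ ∫⁻ x, H.condLik θ (m + k) x y ∂κ := by
  have : IsFiniteMeasure (H.filterMeasure θ m κ y) :=
    ⟨by rw [filterMeasure_univ]; exact hfin.lt_top⟩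
  -- The hypothesis on `κ` passes to the filter at time `m`, whose null sets are null for the hidden
  -- law at that time. The constant `c` depends on `y` and `m` but not on `k`.
  obtain ⟨A, hA, c, hc0, hct, hle⟩ := exists_restrict_le_smul ρ (H.filterMeasure θ m κ y)
    fun S hS h0 => hκ S hS (H.bind_pow_absolutelyContinuous θ hy m κ h0)
  refine ⟨c⁻¹ * 2⁻¹, mul_ne_zero (ENNReal.inv_ne_zero.2 hct) (by simp), fun k => ?_⟩
  set y' : ℕ → Y := fun i => y (m + i) with hy'
  rw [H.lintegral_filterMeasure]
  have hm := H.measurable_cumCost_left θ gs k y'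
  calc _ = c⁻¹ * ((∏ i ∈ Finset.range k, gs (y' i)) *
        (2⁻¹ * negExp (2 * ∫⁻ x, H.cumCost θ gs k x y' ∂ρ))) := by
        rw [H.lintegral_cumCost θ hρ]; ring
    _ ≤ c⁻¹ * ((∏ i ∈ Finset.range k, gs (y' i)) *
        ∫⁻ x in A, negExp (H.cumCost θ gs k x y') ∂ρ) := by
        gcongr
        exact half_mul_negExp_le ρ hm hA
    _ = c⁻¹ * ∫⁻ x in A, (∏ i ∈ Finset.range k, gs (y' i)) *
        negExp (H.cumCost θ gs k x y') ∂ρ := by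
        have hm2 : Measurable fun x => negExp (H.cumCost θ gs k x y') := measurable_negExp.comp hm
        rw [lintegral_const_mul _ hm2]
    _ ≤ c⁻¹ * ∫⁻ x in A, H.condLik θ k x y' ∂ρ := by
        gcongr with x
        exact H.prod_mul_negExp_le θ hgs k x y'
    _ ≤ c⁻¹ * ∫⁻ x, H.condLik θ k x y' ∂(c • H.filterMeasure θ m κ y) := by
        gcongr
    _ = _ := by
        rw [lintegral_smul_measure, smul_eq_mul, ← mul_assoc, ENNReal.inv_mul_cancel hc0 hct,
          one_mul]

theorem lintegral_condLik_ne_zero {κ : Measure X} [IsProbabilityMeasure κ] {y : ℕ → Y}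
    (hy : ∀ i, ∀ᵐ x ∂μ, H.g θ x (y i) ≠ 0) (n : ℕ) : ∫⁻ x, H.condLik θ n x y ∂κ ≠ 0 := by
  rw [← filterMeasure_univ]
  intro h
  have h1 := H.bind_pow_absolutelyContinuous θ hy n κ h
  rw [measure_univ] at h1
  exact one_ne_zero h1

end HMM

end FDPOMM

end BayesPOMM

/-! ### Total variation and i.i.d. sequences. -/

namespace BayesPOMM

theorem measure_le_add_tvNormSub {S : Type*} [MeasurableSpace S] (ρ σ : Measure S)
    [IsFiniteMeasure ρ] [IsFiniteMeasure σ] {A : Set S} (hA : MeasurableSet A) :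
    ρ A ≤ σ A + tvNormSub ρ σ ∧ σ A ≤ ρ A + tvNormSub ρ σ := by
  have h := (ρ.toSignedMeasure - σ.toSignedMeasure).enorm_le_totalVariation A
  have h2 : ‖ρ.real A - σ.real A‖ₑ ≤ tvNormSub ρ σ := by
    refine le_trans (le_of_eq ?_) (h.trans (measure_mono (Set.subset_univ A)))
    rw [sub_apply, Measure.toSignedMeasure_apply_measurable hA,
      Measure.toSignedMeasure_apply_measurable hA]
  have key : ∀ a b : ℝ, 0 ≤ a → 0 ≤ b → ENNReal.ofReal a ≤ ENNReal.ofReal b + ‖a - b‖ₑ := by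
    intro a b _ hb
    rw [Real.enorm_eq_ofReal_abs, ← ENNReal.ofReal_add hb (abs_nonneg _)]
    exact ENNReal.ofReal_le_ofReal (by linarith [le_abs_self (a - b)])
  rw [← ofReal_measureReal (μ := ρ), ← ofReal_measureReal (μ := σ)]
  constructor
  · exact (key _ _ measureReal_nonneg measureReal_nonneg).trans (by gcongr)
  · refine (key (σ.real A) (ρ.real A) measureReal_nonneg measureReal_nonneg).trans ?_
    rw [← enorm_neg, neg_sub]
    gcongr

section InfiniteProduct

variable {Y : Type*} [MeasurableSpace Y] (G : Measure Y) [IsProbabilityMeasure G]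

/-- The sequence with first term `a` followed by the sequence `t`. -/
def consSeq (p : Y × (ℕ → Y)) : ℕ → Y
  | 0 => p.1
  | i + 1 => p.2 i

@[fun_prop]
theorem measurable_consSeq : Measurable (consSeq : Y × (ℕ → Y) → ℕ → Y) := by
  refine measurable_pi_iff.2 fun i => ?_
  cases i with
  | zero => exact measurable_fst
  | succ i => exact (measurable_pi_apply i).comp measurable_snd

theorem map_consSeq_prod_infinitePi :
    (G.prod (Measure.infinitePi fun _ : ℕ => G)).map consSeq = Measure.infinitePi fun _ : ℕ => G := by
  classical
  refine Measure.eq_infinitePi _ fun s t ht => ?_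
  obtain ⟨k, hk⟩ : ∃ k, s ⊆ Finset.range (k + 1) :=
    ⟨s.sup id, fun i hi => Finset.mem_range.2 (Nat.lt_succ_of_le (Finset.le_sup (f := id) hi))⟩
  set E : ℕ → Set Y := fun i => if i ∈ s then t i else Set.univ with hEdef
  have hE : ∀ i, MeasurableSet (E i) := fun i => by
    by_cases hi : i ∈ s <;> simp [hEdef, hi, ht]
  have hpre : consSeq ⁻¹' ((s : Set ℕ).pi t)
      = E 0 ×ˢ (((Finset.range k : Finset ℕ) : Set ℕ).pi fun i => E (i + 1)) := by
    ext ⟨a, y⟩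
    simp only [Set.mem_preimage, Set.mem_pi, Finset.mem_coe, Set.mem_prod, Finset.mem_range]
    constructor
    · intro h
      refine ⟨?_, fun i _ => ?_⟩
      · by_cases hi : 0 ∈ s
        · simpa [hEdef, hi, consSeq] using h 0 hi
        · simp [hEdef, hi]
      · by_cases hi : i + 1 ∈ s
        · simpa [hEdef, hi, consSeq] using h (i + 1) hi
        · simp [hEdef, hi]
    · rintro ⟨h0, h⟩ i hi
      cases i with
      | zero => simpa [hEdef, hi, consSeq] using h0
      | succ i =>
        have := h i (by have := Finset.mem_range.1 (hk hi); omega)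
        simpa [hEdef, hi, consSeq] using this
  rw [Measure.map_apply (by fun_prop) (MeasurableSet.pi (Finset.countable_toSet s) fun i _ => ht i),
    hpre, Measure.prod_prod, Measure.infinitePi_pi _ fun i _ => hE _, mul_comm,
    ← Finset.prod_range_succ' (fun i => G (E i)), ← Finset.prod_subset hk]
  · exact Finset.prod_congr rfl fun i hi => by simp [hEdef, hi]
  · intro i _ hi
    simp [hEdef, hi]

theorem lintegral_infinitePi_consSeq {F : (ℕ → Y) → ℝ≥0∞} (hF : Measurable F) :
    ∫⁻ y, F y ∂(Measure.infinitePi fun _ : ℕ => G)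
      = ∫⁻ a, ∫⁻ t, F (consSeq (a, t)) ∂(Measure.infinitePi fun _ : ℕ => G) ∂G := by
  conv_lhs => rw [← map_consSeq_prod_infinitePi G]
  rw [lintegral_map hF (by fun_prop)]
  exact lintegral_prod _ (hF.comp measurable_consSeq).aemeasurable

theorem ae_infinitePi_forall {p : Y → Prop} (hp : ∀ᵐ a ∂G, p a) :
    ∀ᵐ y ∂(Measure.infinitePi fun _ : ℕ => G), ∀ i, p (y i) :=
  ae_all_iff.2 fun i =>
    (measurePreserving_eval_infinitePi (fun _ : ℕ => G) i).quasiMeasurePreserving.ae hp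

/-- The strong law of large numbers, as an upper bound for extended nonnegative functions. -/
theorem ae_eventually_sum_le {h : Y → ℝ≥0∞} (hh : Measurable h) {τ : ℝ} (hτ : 0 < τ)
    (hint : ∫⁻ a, h a ∂G ≤ ENNReal.ofReal τ) :
    ∀ᵐ y ∂(Measure.infinitePi fun _ : ℕ => G), ∀ᶠ n : ℕ in atTop,
      ∑ i ∈ Finset.range n, h (y i) ≤ ENNReal.ofReal (2 * τ * n) := by
  have hne : ∫⁻ a, h a ∂G ≠ ⊤ := ne_top_of_le_ne_top ENNReal.ofReal_ne_top hint
  set P := Measure.infinitePi fun _ : ℕ => G with hP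
  have hmp := fun i => measurePreserving_eval_infinitePi (fun _ : ℕ => G) i
  have hI : Integrable (fun a => (h a).toReal) G :=
    integrable_toReal_of_lintegral_ne_top hh.aemeasurable hne
  have hind : iIndepFun (fun i (y : ℕ → Y) => (h (y i)).toReal) P :=
    iIndepFun_infinitePi (P := fun _ : ℕ => G) (X := fun _ a => (h a).toReal)
      (fun _ => hh.ennreal_toReal)
  have hmY : ∀ i, Measurable fun y : ℕ → Y => (h (y i)).toReal := fun i =>
    (hh.comp (measurable_pi_apply i)).ennreal_toReal
  have hlaw : ∀ i, P.map (fun y : ℕ → Y => (h (y i)).toReal) = G.map fun a => (h a).toReal := by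
    intro i
    rw [← (hmp i).map_eq, Measure.map_map hh.ennreal_toReal (measurable_pi_apply i)]
    rfl
  have hslln := strong_law_ae_real (μ := P) (fun i (y : ℕ → Y) => (h (y i)).toReal)
    ((hmp 0).integrable_comp_of_integrable hI)
    (fun i j hij => hind.indepFun hij)
    (fun i => ⟨(hmY i).aemeasurable, (hmY 0).aemeasurable, by rw [hlaw, hlaw]⟩)
  -- The factor `2` leaves strict room above the mean, so that the averages are eventually below the
  -- bound.
  have hmean : ∫ y, (h (y 0)).toReal ∂P < 2 * τ := by
    have h1 : ∫ y, (h (y 0)).toReal ∂P = ∫ a, (h a).toReal ∂G := by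
      rw [← (hmp 0).map_eq, integral_map (measurable_pi_apply 0).aemeasurable
        hh.ennreal_toReal.aestronglyMeasurable]
    rw [h1, integral_toReal hh.aemeasurable (ae_lt_top hh hne)]
    have h2 := ENNReal.toReal_mono ENNReal.ofReal_ne_top hint
    rw [ENNReal.toReal_ofReal hτ.le] at h2
    linarith
  filter_upwards [hslln, ae_infinitePi_forall G (ae_lt_top hh hne)] with y hy hfin
  filter_upwards [hy.eventually (gt_mem_nhds hmean), eventually_gt_atTop 0] with n hn hn0
  have hn0' : (0 : ℝ) < n := by exact_mod_cast hn0
  rw [div_lt_iff₀ hn0'] at hn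
  calc ∑ i ∈ Finset.range n, h (y i) = ∑ i ∈ Finset.range n, ENNReal.ofReal (h (y i)).toReal :=
        Finset.sum_congr rfl fun i _ => (ENNReal.ofReal_toReal (hfin i).ne).symm
    _ = ENNReal.ofReal (∑ i ∈ Finset.range n, (h (y i)).toReal) :=
        (ENNReal.ofReal_sum_of_nonneg fun _ _ => ENNReal.toReal_nonneg).symm
    _ ≤ _ := ENNReal.ofReal_le_ofReal hn.le

end InfiniteProduct

/-! ### Likelihoods under i.i.d. observations with density `gs`. -/

namespace FDPOMM

variable {Θ X Y : Type*} [MeasurableSpace Θ] [MeasurableSpace X] [MeasurableSpace Y]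
  {μ : Measure X} {ν : Measure Y} [SigmaFinite μ] [SigmaFinite ν] {M : FDPOMM Θ X Y μ ν}

theorem measurable_likelihood (M : FDPOMM Θ X Y μ ν) (η : Measure (X × Y)) [SFinite η] (n : ℕ) :
    Measurable fun p : Θ × (Fin n → Y) => M.likelihood p.1 η p.2 := by
  have hz : Measurable fun p : ((Θ × (Fin n → Y)) × (X × Y)) × (Fin n → X) =>
      (Fin.cons p.1.2 (fun i => (p.2 i, p.1.1.2 i)) : Fin (n + 1) → X × Y) := by
    refine measurable_pi_iff.2 fun i => ?_
    refine Fin.cases ?_ (fun i => ?_) i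
    · simp only [Fin.cons_zero]; fun_prop
    · simp only [Fin.cons_succ]; fun_prop
  have hprod : Measurable fun p : ((Θ × (Fin n → Y)) × (X × Y)) × (Fin n → X) =>
      (let z : Fin (n + 1) → X × Y := Fin.cons p.1.2 (fun i => (p.2 i, p.1.1.2 i))
       ∏ i : Fin n, M.q p.1.1.1 (z i.castSucc) (z i.succ)) := by
    refine Finset.measurable_prod _ fun i _ => ?_
    have hz2 : Measurable fun p : ((Θ × (Fin n → Y)) × (X × Y)) × (Fin n → X) =>
        (p.1.1.1, (Fin.cons p.1.2 (fun i => (p.2 i, p.1.1.2 i)) : Fin (n + 1) → X × Y) i.castSucc,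
          (Fin.cons p.1.2 (fun i => (p.2 i, p.1.1.2 i)) : Fin (n + 1) → X × Y) i.succ) :=
      (by fun_prop : Measurable fun p : ((Θ × (Fin n → Y)) × (X × Y)) × (Fin n → X) =>
        p.1.1.1).prodMk (((measurable_pi_apply _).comp hz).prodMk
          ((measurable_pi_apply _).comp hz))
    exact M.measurable_q.comp hz2
  exact (hprod.lintegral_prod_right').lintegral_prod_right'

/-- The likelihood of the first `n` terms of a sequence of observations. -/
noncomputable def likSeq (M : FDPOMM Θ X Y μ ν) (θ : Θ) (η : Measure (X × Y)) (n : ℕ)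
    (y : ℕ → Y) : ℝ≥0∞ := M.likelihood θ η (fun i : Fin n => y i)

theorem likelihood_obs (M : FDPOMM Θ X Y μ ν) (θ : Θ) (η : Measure (X × Y)) (n : ℕ)
    (ω : ℕ → X × Y) : M.likelihood θ η (obs n ω) = M.likSeq θ η n (obsSeq ω) := rfl

theorem measurable_likSeq (M : FDPOMM Θ X Y μ ν) (η : Measure (X × Y)) [SFinite η] (n : ℕ) :
    Measurable fun p : Θ × (ℕ → Y) => M.likSeq p.1 η n p.2 :=
  (M.measurable_likelihood η n).comp (by fun_prop : Measurable fun p : Θ × (ℕ → Y) =>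
    (p.1, fun i : Fin n => p.2 i))

namespace HMM

/-- A likelihood ratio has mean one. The induction integrates the tail of the sequence, then its
first term against `g`, of total mass one. -/
theorem lintegral_condLik_mul_inv (H : M.HMM) (θ : Θ) {gs : Y → ℝ≥0∞} (hgs : Measurable gs)
    (h0 : ∀ y, gs y ≠ 0) (ht : ∀ y, gs y ≠ ⊤) [IsProbabilityMeasure (ν.withDensity gs)]
    (n : ℕ) (x : X) :
    ∫⁻ y, H.condLik θ n x y * (∏ i ∈ Finset.range n, gs (y i))⁻¹
      ∂(Measure.infinitePi fun _ : ℕ => ν.withDensity gs) = 1 := by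
  have hprod : ∀ n : ℕ, Measurable fun y : ℕ → Y => (∏ i ∈ Finset.range n, gs (y i))⁻¹ := fun n =>
    (Finset.measurable_prod _ fun i _ => hgs.comp (measurable_pi_apply i)).inv
  have hcl : ∀ (n : ℕ) (x : X), Measurable fun y => H.condLik θ n x y := fun n x =>
    (H.measurable_condLik θ n).comp measurable_prodMk_left
  induction n generalizing x with
  | zero => simp [condLik]
  | succ n ih =>
    refine (lintegral_infinitePi_consSeq _ ((hcl (n + 1) x).mul (hprod (n + 1)))).trans ?_
    simp only [Pi.mul_apply]
    set P := Measure.infinitePi fun _ : ℕ => ν.withDensity gs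
    have hinv : ∀ (a : Y) (t : ℕ → Y), (∏ i ∈ Finset.range (n + 1), gs (consSeq (a, t) i))⁻¹
        = (gs a)⁻¹ * (∏ i ∈ Finset.range n, gs (t i))⁻¹ := by
      intro a t
      rw [Finset.prod_range_succ', mul_comm,
        ENNReal.mul_inv (Or.inl (h0 _)) (Or.inl (ht _))]
      rfl
    have hjoint : Measurable fun p : (Y × (ℕ → Y)) × X => H.g θ p.2 p.1.1 *
        H.condLik θ n p.2 p.1.2 * ((gs p.1.1)⁻¹ * (∏ i ∈ Finset.range n, gs (p.1.2 i))⁻¹) := by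
      refine Measurable.mul (Measurable.mul ?_ ?_) (Measurable.mul ?_ ?_)
      · exact (H.measurable_g θ).comp (by fun_prop : Measurable fun p : (Y × (ℕ → Y)) × X =>
          (p.2, p.1.1))
      · exact (H.measurable_condLik θ n).comp
          (by fun_prop : Measurable fun p : (Y × (ℕ → Y)) × X => (p.2, p.1.2))
      · exact (hgs.comp (by fun_prop)).inv
      · exact (hprod n).comp (by fun_prop : Measurable fun p : (Y × (ℕ → Y)) × X => p.1.2)
    have h1 : ∀ a t, H.condLik θ (n + 1) x (consSeq (a, t)) *
        (∏ i ∈ Finset.range (n + 1), gs (consSeq (a, t) i))⁻¹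
        = ∫⁻ x', H.g θ x' a * H.condLik θ n x' t *
            ((gs a)⁻¹ * (∏ i ∈ Finset.range n, gs (t i))⁻¹) ∂(H.QX θ x) := by
      intro a t
      rw [hinv]
      exact (lintegral_mul_const _ ((H.measurable_g_right θ a).mul
        (H.measurable_condLik_left θ n t))).symm
    have h2 : ∀ a, ∫⁻ t, ∫⁻ x', H.g θ x' a * H.condLik θ n x' t *
            ((gs a)⁻¹ * (∏ i ∈ Finset.range n, gs (t i))⁻¹) ∂(H.QX θ x) ∂P
        = ∫⁻ x', H.g θ x' a * (gs a)⁻¹ ∂(H.QX θ x) := by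
      intro a
      rw [lintegral_lintegral_swap]
      · refine lintegral_congr fun x' => ?_
        have h3 : ∀ t, H.g θ x' a * H.condLik θ n x' t *
            ((gs a)⁻¹ * (∏ i ∈ Finset.range n, gs (t i))⁻¹)
            = (H.g θ x' a * (gs a)⁻¹) *
              (H.condLik θ n x' t * (∏ i ∈ Finset.range n, gs (t i))⁻¹) := fun t => by ring
        simp_rw [h3]
        refine (lintegral_const_mul _ ((hcl n x').mul (hprod n))).trans ?_
        refine Eq.trans ?_ (mul_one (H.g θ x' a * (gs a)⁻¹))
        exact congrArg (H.g θ x' a * (gs a)⁻¹ * ·) (ih x')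
      · exact (hjoint.comp (by fun_prop : Measurable fun p : (ℕ → Y) × X =>
          (((a, p.1), p.2) : (Y × (ℕ → Y)) × X))).aemeasurable
    simp_rw [h1, h2]
    rw [lintegral_lintegral_swap]
    · have h4 : ∀ x', ∫⁻ a, H.g θ x' a * (gs a)⁻¹ ∂(ν.withDensity gs) = 1 := by
        intro x'
        have hm : Measurable fun a => H.g θ x' a * (gs a)⁻¹ :=
          (H.measurable_g_left θ x').mul hgs.inv
        rw [lintegral_withDensity_eq_lintegral_mul _ hgs hm, ← H.lintegral_g θ x']
        refine lintegral_congr fun a => ?_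
        simp only [Pi.mul_apply]
        rw [mul_left_comm, ENNReal.mul_inv_cancel (h0 a) (ht a), mul_one]
      simp_rw [h4]
      simp
    · refine Measurable.aemeasurable ?_
      exact ((H.measurable_g θ).comp (by fun_prop : Measurable fun p : Y × X => (p.2, p.1))).mul
        (hgs.comp measurable_fst).inv

theorem likSeq_eq (H : M.HMM) (θ : Θ) (η : Measure (X × Y)) (n : ℕ) (y : ℕ → Y) :
    M.likSeq θ η n y = ∫⁻ x, H.condLik θ n x y ∂η.fst := H.likelihood_eq θ η n y

/-- Fubini exchanges the quantifiers: positivity for almost every `y` at each `x` becomes positivity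
for almost every `x` at each typical observation. -/
theorem ae_g_ne_zero (H : M.HMM) {θ : Θ} (hg : ∀ x, ∀ᵐ y ∂ν, 0 < H.g θ x y) {gs : Y → ℝ≥0∞}
    [IsProbabilityMeasure (ν.withDensity gs)] :
    ∀ᵐ y ∂(Measure.infinitePi fun _ : ℕ => ν.withDensity gs), ∀ i,
      ∀ᵐ x ∂μ, H.g θ x (y i) ≠ 0 := by
  refine ae_infinitePi_forall (p := fun a => ∀ᵐ x ∂μ, H.g θ x a ≠ 0) _
    ((withDensity_absolutelyContinuous ν gs).ae_le ?_)
  have hm : MeasurableSet {p : X × Y | H.g θ p.1 p.2 ≠ 0} :=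
    (H.measurable_g θ) (measurableSet_singleton 0).compl
  exact (Measure.ae_ae_comm hm).1 (ae_of_all _ fun x => (hg x).mono fun y hy => hy.ne')

namespace ConstEmission

variable {H : M.HMM} {θs : Θ} {ρ : Measure X} [IsProbabilityMeasure ρ] {gs : Y → ℝ≥0∞} {N : Set X}
  [IsProbabilityMeasure (ν.withDensity gs)]

theorem ae_ae_g_eq (C : H.ConstEmission θs ρ gs N) :
    ∀ᵐ y ∂ν, ∀ᵐ x ∂ρ, H.g θs x y = gs y := by
  have hm : MeasurableSet {p : X × Y | H.g θs p.1 p.2 = gs p.2} :=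
    measurableSet_eq_fun (H.measurable_g θs) (C.measurable_gs.comp measurable_snd)
  refine (Measure.ae_ae_comm hm).1 ?_
  filter_upwards [measure_eq_zero_iff_ae_notMem.1 C.null] with x hx using C.emission x hx

/-- The true parameter thus meets the cost condition of `ae_eventually_le_likSeq` for every `τ`,
which compares its likelihoods started from `η` and from stationarity. -/
theorem lintegral_cost_eq_zero (C : H.ConstEmission θs ρ gs N) :
    ∫⁻ y, ∫⁻ x, H.cost θs gs x y ∂ρ ∂(ν.withDensity gs) = 0 := by
  refine (lintegral_congr_ae ?_).trans lintegral_zero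
  filter_upwards [(withDensity_absolutelyContinuous ν gs).ae_le C.ae_ae_g_eq] with y hy
  refine (lintegral_congr_ae ?_).trans lintegral_zero
  filter_upwards [hy] with x hx
  simp [cost, hx, ENNReal.div_self (C.gs_ne_zero y) (C.gs_ne_top y), logPlus]

theorem ae_likSeq_eq_prod (C : H.ConstEmission θs ρ gs N) (hρ : (H.QX θs).Invariant ρ)
    {π : Measure (X × Y)} (hπ : π.fst = ρ) :
    ∀ᵐ y ∂(Measure.infinitePi fun _ : ℕ => ν.withDensity gs), ∀ n,
      M.likSeq θs π n y = ∏ i ∈ Finset.range n, gs (y i) := by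
  have h := ae_infinitePi_forall (p := fun a => ∀ᵐ x ∂ρ, H.g θs x a = gs a) (ν.withDensity gs)
    ((withDensity_absolutelyContinuous ν gs).ae_le C.ae_ae_g_eq)
  filter_upwards [h] with y hy n
  have key : ∀ (n : ℕ) (y : ℕ → Y), (∀ i, ∀ᵐ x ∂ρ, H.g θs x (y i) = gs (y i)) →
      ∀ᵐ x ∂ρ, H.condLik θs n x y = ∏ i ∈ Finset.range n, gs (y i) := by
    intro n
    induction n with
    | zero => intro y _; simp [condLik]
    | succ n ih =>
      intro y hy
      have h1 := (hy 0).and (ih (fun i => y (i + 1)) fun i => hy (i + 1))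
      rw [← hρ.def] at h1
      -- By invariance, a property true `ρ`-almost everywhere is true after one transition from
      -- `ρ`-almost every state.
      filter_upwards [Measure.ae_ae_of_ae_bind (H.QX θs).aemeasurable h1] with x hx
      rw [condLik, Finset.prod_range_succ', mul_comm]
      have h2 : ∀ᵐ x' ∂(H.QX θs x), H.g θs x' (y 0) * H.condLik θs n x' (fun i => y (i + 1))
          = gs (y 0) * ∏ i ∈ Finset.range n, gs (y (i + 1)) := by
        filter_upwards [hx] with x' hx'
        rw [hx'.1, hx'.2]
      rw [lintegral_congr_ae h2]
      simp
  rw [H.likSeq_eq, hπ, lintegral_congr_ae (key n y hy)]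
  simp

/-- By Tonelli the prior integral of the likelihood ratio to `∏ gs (y i)` has mean equal to the mass
of `lam`, hence is almost surely finite; the product is finite too. -/
theorem ae_lintegral_likSeq_lt_top (C : H.ConstEmission θs ρ gs N) (lam : Measure Θ)
    [IsFiniteMeasure lam] (η : Measure (X × Y)) [IsProbabilityMeasure η] :
    ∀ᵐ y ∂(Measure.infinitePi fun _ : ℕ => ν.withDensity gs), ∀ n,
      ∫⁻ θ, M.likSeq θ η n y ∂lam < ⊤ := by
  refine ae_all_iff.2 fun n => ?_
  set P := Measure.infinitePi fun _ : ℕ => ν.withDensity gs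
  have hprod : Measurable fun y : ℕ → Y => (∏ i ∈ Finset.range n, gs (y i))⁻¹ :=
    (Finset.measurable_prod _ fun i _ => C.measurable_gs.comp (measurable_pi_apply i)).inv
  have hpt : ∀ y : ℕ → Y, (∏ i ∈ Finset.range n, gs (y i))⁻¹ ≠ 0 := fun y =>
    ENNReal.inv_ne_zero.2 (ENNReal.prod_ne_top fun i _ => C.gs_ne_top _)
  have hlik := M.measurable_likSeq η n
  have hlikl : ∀ y, Measurable fun θ => M.likSeq θ η n y := fun y =>
    hlik.comp (by fun_prop : Measurable fun θ : Θ => (θ, y))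
  have hmeas : Measurable fun p : (ℕ → Y) × Θ =>
      M.likSeq p.2 η n p.1 * (∏ i ∈ Finset.range n, gs (p.1 i))⁻¹ :=
    (hlik.comp (by fun_prop : Measurable fun p : (ℕ → Y) × Θ => (p.2, p.1))).mul
      (hprod.comp measurable_fst)
  have h1 : ∀ θ, ∫⁻ y, M.likSeq θ η n y * (∏ i ∈ Finset.range n, gs (y i))⁻¹ ∂P = 1 := by
    intro θ
    have h2 : ∀ y, M.likSeq θ η n y * (∏ i ∈ Finset.range n, gs (y i))⁻¹
        = ∫⁻ x, H.condLik θ n x y * (∏ i ∈ Finset.range n, gs (y i))⁻¹ ∂η.fst := fun y => by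
      rw [H.likSeq_eq, lintegral_mul_const _ (H.measurable_condLik_left θ n y)]
    simp_rw [h2]
    rw [lintegral_lintegral_swap]
    · refine (lintegral_congr fun x => H.lintegral_condLik_mul_inv θ C.measurable_gs C.gs_ne_zero
        C.gs_ne_top n x).trans ?_
      simp
    · exact (((H.measurable_condLik θ n).comp (by fun_prop : Measurable fun p : (ℕ → Y) × X =>
        (p.2, p.1))).mul (hprod.comp measurable_fst)).aemeasurable
  have h3 : ∫⁻ y, ∫⁻ θ, M.likSeq θ η n y * (∏ i ∈ Finset.range n, gs (y i))⁻¹ ∂lam ∂P ≠ ⊤ := by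
    rw [lintegral_lintegral_swap hmeas.aemeasurable]
    simp_rw [h1]
    simp
  filter_upwards [ae_lt_top hmeas.lintegral_prod_right' h3] with y hy
  rw [lintegral_mul_const _ (hlikl y)] at hy
  by_contra hcon
  rw [not_lt, top_le_iff] at hcon
  rw [hcon, ENNReal.top_mul (hpt y)] at hy
  exact hy.ne rfl

theorem ae_likSeq_lt_top (C : H.ConstEmission θs ρ gs N) (θ : Θ)
    (η : Measure (X × Y)) [IsProbabilityMeasure η] :
    ∀ᵐ y ∂(Measure.infinitePi fun _ : ℕ => ν.withDensity gs), ∀ n, M.likSeq θ η n y < ⊤ := by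
  filter_upwards [C.ae_lintegral_likSeq_lt_top (Measure.dirac θ) η] with y hy n
  have h := hy n
  have hm : Measurable fun θ => M.likSeq θ η n y := (M.measurable_likSeq η n).comp
    (by fun_prop : Measurable fun θ : Θ => (θ, y))
  rwa [lintegral_dirac' _ hm] at h

/-- Almost surely, the likelihood of a parameter of small cost is eventually exponentially close
to the likelihood of the true parameter. -/
theorem ae_eventually_le_likSeq (C : H.ConstEmission θs ρ gs N) {θ : Θ}
    (hg : ∀ x, ∀ᵐ y ∂ν, 0 < H.g θ x y) {σ : Measure X} [IsProbabilityMeasure σ]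
    (hσ : (H.QX θ).Invariant σ) (η : Measure (X × Y)) [IsProbabilityMeasure η]
    (hTV : Tendsto (fun n : ℕ => tvNormSub (η.fst.bind (H.QX θ ^ n)) σ) atTop (𝓝 0))
    {τ : ℝ} (hτ : 0 < τ)
    (hcost : ∫⁻ y, ∫⁻ x, H.cost θ gs x y ∂σ ∂(ν.withDensity gs) ≤ ENNReal.ofReal τ) :
    ∀ᵐ y ∂(Measure.infinitePi fun _ : ℕ => ν.withDensity gs), ∀ᶠ n : ℕ in atTop,
      ENNReal.ofReal (Real.exp (-(5 * τ * n))) * ∏ i ∈ Finset.range n, gs (y i)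
        ≤ M.likSeq θ η n y := by
  obtain ⟨m, hm⟩ := (hTV.eventually (gt_mem_nhds (show (0 : ℝ≥0∞) < 4⁻¹ by simp))).exists
  have hκ : ∀ S, MeasurableSet S → (η.fst.bind (H.QX θ ^ m)) S = 0 → σ S ≤ 4⁻¹ := by
    intro S hS h0
    have h := (measure_le_add_tvNormSub (η.fst.bind (H.QX θ ^ m)) σ hS).2
    rw [h0, zero_add] at h
    exact h.trans hm.le
  have hcm : Measurable fun y => ∫⁻ x, H.cost θ gs x y ∂σ :=
    ((H.measurable_cost θ C.measurable_gs).comp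
      (by fun_prop : Measurable fun p : Y × X => (p.2, p.1))).lintegral_prod_right'
  filter_upwards [H.ae_g_ne_zero hg, C.ae_likSeq_lt_top θ η,
    ae_eventually_sum_le (ν.withDensity gs) hcm hτ hcost] with y hy hfin hsum
  have hfin' : ∫⁻ x, H.condLik θ m x y ∂η.fst ≠ ⊤ := by
    rw [← H.likSeq_eq]; exact (hfin m).ne
  obtain ⟨c, hc0, hc⟩ := H.exists_mul_le_lintegral_condLik θ hσ C.gs_ne_top hκ hy hfin'
  have hPm : ∏ i ∈ Finset.range m, gs (y i) ≠ ⊤ := ENNReal.prod_ne_top fun i _ => C.gs_ne_top _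
  -- The rate `5 τ` is `4 τ + τ`. The strong law and the restricted Jensen inequality each
  -- contribute a factor `2` to the first term; the factor `exp (-τ n)` absorbs the constant `c` and
  -- the first `m` densities.
  have hlim : Tendsto (fun n : ℕ => ENNReal.ofReal (Real.exp (-(τ * n))) *
      ∏ i ∈ Finset.range m, gs (y i)) atTop (𝓝 0) := by
    have h1 : Tendsto (fun n : ℕ => Real.exp (-(τ * n))) atTop (𝓝 0) :=
      Real.tendsto_exp_neg_atTop_nhds_zero.comp
        (tendsto_natCast_atTop_atTop.const_mul_atTop hτ)
    have h2 := ENNReal.Tendsto.mul_const (ENNReal.tendsto_ofReal h1) (b := ∏ i ∈ Finset.range m,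
      gs (y i)) (Or.inr hPm)
    simpa using h2
  filter_upwards [hsum, hlim.eventually (gt_mem_nhds (pos_iff_ne_zero.2 hc0)),
    eventually_ge_atTop m] with n hn1 hn2 hnm
  obtain ⟨k, rfl⟩ := Nat.exists_eq_add_of_le hnm
  rw [H.likSeq_eq]
  refine le_trans ?_ (hc k)
  have hs : 2 * ∑ i ∈ Finset.range k, ∫⁻ x, H.cost θ gs x (y (m + i)) ∂σ
      ≤ ENNReal.ofReal (4 * τ * (m + k : ℕ)) := by
    have h5 : 4 * τ * ((m + k : ℕ) : ℝ) = 2 * (2 * τ * (m + k : ℕ)) := by ring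
    rw [h5, ENNReal.ofReal_mul (by norm_num : (0 : ℝ) ≤ 2), ENNReal.ofReal_ofNat]
    gcongr
    refine le_trans ?_ hn1
    rw [Finset.sum_range_add]
    exact le_add_self
  have he : ENNReal.ofReal (Real.exp (-(5 * τ * (m + k : ℕ))))
      = ENNReal.ofReal (Real.exp (-(τ * (m + k : ℕ)))) *
        ENNReal.ofReal (Real.exp (-(4 * τ * (m + k : ℕ)))) := by
    rw [← ENNReal.ofReal_mul (Real.exp_nonneg _), ← Real.exp_add]
    congr 2; ring
  rw [he, Finset.prod_range_add, ← negExp_ofReal (v := 4 * τ * (m + k : ℕ)) (by positivity)]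
  calc _ = (ENNReal.ofReal (Real.exp (-(τ * (m + k : ℕ)))) * ∏ i ∈ Finset.range m, gs (y i)) *
        (∏ i ∈ Finset.range k, gs (y (m + i))) *
          negExp (ENNReal.ofReal (4 * τ * (m + k : ℕ))) := by ring
    _ ≤ _ := by
      gcongr
      exact negExp_antitone hs

end ConstEmission

end HMM

end FDPOMM

end BayesPOMM

/-! ### Small divergence forces a constant emission density. -/

namespace BayesPOMM

namespace FDPOMM

namespace HMM

variable {Θ X Y : Type*} [MeasurableSpace Θ] [MeasurableSpace X] [MeasurableSpace Y]
  {μ : Measure X} {ν : Measure Y} [SigmaFinite μ] [SigmaFinite ν] {M : FDPOMM Θ X Y μ ν}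
  (H : M.HMM)

/-- The divergence `∫ g log⁺ (g / g')` between two emission densities. -/
noncomputable def emissionCost (θs θ : Θ) (p : X × X) : ℝ≥0∞ :=
  ∫⁻ y, H.g θs p.1 y * logPlus (H.g θs p.1 y / H.g θ p.2 y) ∂ν

theorem measurable_emissionCost (θs θ : Θ) : Measurable (H.emissionCost θs θ) := by
  have h1 : Measurable fun p : (X × X) × Y => H.g θs p.1.1 p.2 :=
    (H.measurable_g θs).comp (by fun_prop : Measurable fun p : (X × X) × Y => (p.1.1, p.2))
  have h2 : Measurable fun p : (X × X) × Y => H.g θ p.1.2 p.2 :=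
    (H.measurable_g θ).comp (by fun_prop : Measurable fun p : (X × X) × Y => (p.1.2, p.2))
  exact (h1.mul (measurable_logPlus.comp (h1.div h2))).lintegral_prod_right'

theorem exists_emissionKL_imp (hg : ∀ θ x, ∀ᵐ y ∂ν, 0 < H.g θ x y)
    (π : Θ → Measure (X × Y)) [∀ θ, IsProbabilityMeasure (π θ)] (θs : Θ) {τ : ℝ} (hτ : 0 < τ) :
    ∃ δ : ℝ, 0 < δ ∧ ∀ θ, H.emissionKL π θs θ ≤ ENNReal.ofReal δ →
      ∫⁻ p, H.emissionCost θs θ p ∂((π θs).fst.prod (π θ).fst) ≤ ENNReal.ofReal τ := by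
  have hc : 0 < 1 + (τ / 2)⁻¹ := by positivity
  -- With error `τ / 2` in `lintegral_mul_logPlus_le_klDiv`, this `δ` makes the divergence term
  -- equal to the other half of `τ`.
  refine ⟨(τ / 2) / (1 + (τ / 2)⁻¹), by positivity, fun θ hθ => ?_⟩
  calc ∫⁻ p, H.emissionCost θs θ p ∂((π θs).fst.prod (π θ).fst)
      ≤ ∫⁻ p, (ENNReal.ofReal (1 + (τ / 2)⁻¹) * InformationTheory.klDiv
          (ν.withDensity (H.g θs p.1)) (ν.withDensity (H.g θ p.2)) + ENNReal.ofReal (τ / 2))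
          ∂((π θs).fst.prod (π θ).fst) := by
        refine lintegral_mono fun p => ?_
        exact lintegral_mul_logPlus_le_klDiv (H.measurable_g_left θs _) (H.measurable_g_left θ _)
          (H.lintegral_g _ _) (H.lintegral_g _ _) (hg _ _) (by positivity)
    _ = ENNReal.ofReal (1 + (τ / 2)⁻¹) * H.emissionKL π θs θ + ENNReal.ofReal (τ / 2) := by
        -- No measurability of the divergence in `p` is needed: the added term is constant and the
        -- multiplier is finite.
        rw [lintegral_add_right _ measurable_const, lintegral_const_mul' _ _ ENNReal.ofReal_ne_top]
        simp [emissionKL]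
    _ ≤ ENNReal.ofReal (1 + (τ / 2)⁻¹) * ENNReal.ofReal ((τ / 2) / (1 + (τ / 2)⁻¹))
          + ENNReal.ofReal (τ / 2) := by gcongr
    _ = ENNReal.ofReal τ := by
        rw [← ENNReal.ofReal_mul hc.le, ← ENNReal.ofReal_add (by positivity) (by positivity)]
        congr 1
        field_simp
        ring

/-- The positive part of the difference of two emission densities, integrated. -/
theorem measurable_lintegral_g_tsub (θs : Θ) :
    Measurable fun p : X × X => ∫⁻ y, (H.g θs p.1 y - H.g θs p.2 y) ∂ν := by
  have h1 : Measurable fun p : (X × X) × Y => H.g θs p.1.1 p.2 :=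
    (H.measurable_g θs).comp (by fun_prop : Measurable fun p : (X × X) × Y => (p.1.1, p.2))
  have h2 : Measurable fun p : (X × X) × Y => H.g θs p.1.2 p.2 :=
    (H.measurable_g θs).comp (by fun_prop : Measurable fun p : (X × X) × Y => (p.1.2, p.2))
  exact (h1.sub h2).lintegral_prod_right'

/-- The product structure allows one `x'` to be fixed at which the average cost over `x` is at most
the double integral. The triangle inequality through `g_θ(x', ·)` then compares any two `x₁`, `x₂`,
whence the factor `2`. -/
theorem lintegral_g_tsub_le {θs θ : Θ} {ρ σ : Measure X} [IsProbabilityMeasure ρ]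
    [IsProbabilityMeasure σ] :
    ∫⁻ x₁, ∫⁻ x₂, ∫⁻ y, (H.g θs x₁ y - H.g θs x₂ y) ∂ν ∂ρ ∂ρ
      ≤ 2 * ∫⁻ p, H.emissionCost θs θ p ∂(ρ.prod σ) := by
  have hD := H.measurable_emissionCost θs θ
  rw [lintegral_prod_symm _ hD.aemeasurable]
  obtain ⟨x', hx'⟩ : ∃ x', ∫⁻ x, H.emissionCost θs θ (x, x') ∂ρ
      ≤ ∫⁻ x', ∫⁻ x, H.emissionCost θs θ (x, x') ∂ρ ∂σ :=
    exists_le_lintegral hD.lintegral_prod_left'.aemeasurable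
  refine le_trans ?_ (mul_le_mul_right hx' 2)
  have hgm : ∀ x, Measurable (H.g θs x) := H.measurable_g_left θs
  have hqm : Measurable (H.g θ x') := H.measurable_g_left θ x'
  have hle : ∀ x, ∫⁻ y, (H.g θs x y - H.g θ x' y) ∂ν ≤ H.emissionCost θs θ (x, x') := by
    intro x
    refine lintegral_mono_ae ?_
    filter_upwards [ae_lt_top (hgm x) (by simp [H.lintegral_g] : ∫⁻ y, H.g θs x y ∂ν ≠ ⊤)]
      with y hy using tsub_le_mul_logPlus hy.ne _
  have htri : ∀ x₁ x₂, ∫⁻ y, (H.g θs x₁ y - H.g θs x₂ y) ∂ν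
      ≤ H.emissionCost θs θ (x₁, x') + H.emissionCost θs θ (x₂, x') := by
    intro x₁ x₂
    calc ∫⁻ y, (H.g θs x₁ y - H.g θs x₂ y) ∂ν
        ≤ ∫⁻ y, ((H.g θs x₁ y - H.g θ x' y) + (H.g θ x' y - H.g θs x₂ y)) ∂ν :=
          lintegral_mono fun y => tsub_le_tsub_add_tsub
      _ = ∫⁻ y, (H.g θs x₁ y - H.g θ x' y) ∂ν + ∫⁻ y, (H.g θs x₂ y - H.g θ x' y) ∂ν := by
          have hs : Measurable fun y => H.g θs x₁ y - H.g θ x' y := (hgm x₁).sub hqm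
          rw [lintegral_add_left hs, lintegral_tsub_comm hqm (hgm x₂)
            (H.lintegral_g _ _) (H.lintegral_g _ _)]
      _ ≤ _ := add_le_add (hle _) (hle _)
  have hDx : Measurable fun x => H.emissionCost θs θ (x, x') := hD.comp measurable_prodMk_right
  calc _ ≤ ∫⁻ x₁, ∫⁻ x₂, (H.emissionCost θs θ (x₁, x') + H.emissionCost θs θ (x₂, x')) ∂ρ ∂ρ :=
        lintegral_mono fun x₁ => lintegral_mono fun x₂ => htri x₁ x₂
    _ = _ := by
      simp_rw [lintegral_add_left measurable_const, lintegral_const, measure_univ, mul_one]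
      rw [lintegral_add_left hDx, lintegral_const, measure_univ, mul_one, two_mul]

/-- If parameters of arbitrarily small divergence exist, then the emission density does not depend
on the hidden state, up to stationary null sets. -/
theorem exists_ae_g_eq {θs : Θ} {ρ : Measure X} [IsProbabilityMeasure ρ]
    (h : ∀ τ : ℝ, 0 < τ → ∃ θ, ∃ σ : Measure X, IsProbabilityMeasure σ ∧
      ∫⁻ p, H.emissionCost θs θ p ∂(ρ.prod σ) ≤ ENNReal.ofReal τ) :
    ∃ x₀, ∀ᵐ x ∂ρ, H.g θs x =ᵐ[ν] H.g θs x₀ := by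
  have h0 : ∫⁻ x₁, ∫⁻ x₂, ∫⁻ y, (H.g θs x₁ y - H.g θs x₂ y) ∂ν ∂ρ ∂ρ = 0 := by
    refine le_antisymm (ENNReal.le_of_forall_pos_le_add fun ε hε _ => ?_) zero_le
    obtain ⟨θ, σ, hσ, hθ⟩ := h (ε / 2) (by positivity)
    refine H.lintegral_g_tsub_le.trans ((mul_le_mul_right hθ 2).trans ?_)
    rw [← ENNReal.ofReal_ofNat, ← ENNReal.ofReal_mul (by norm_num), zero_add]
    rw [mul_div_cancel₀ _ (by norm_num), ENNReal.ofReal_coe_nnreal]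
  have hm := H.measurable_lintegral_g_tsub θs
  rw [lintegral_eq_zero_iff hm.lintegral_prod_right'] at h0
  obtain ⟨x₀, hx₀⟩ := h0.exists
  have hx₀' := (lintegral_eq_zero_iff (hm.comp (measurable_prodMk_left (x := x₀)))).1 hx₀
  refine ⟨x₀, ?_⟩
  filter_upwards [hx₀'] with x hx
  have hgm : ∀ x, Measurable (H.g θs x) := H.measurable_g_left θs
  have hx' := (lintegral_eq_zero_iff ((hgm x₀).sub (hgm x))).1 hx
  -- A one-sided inequality is enough, since both densities have integral one.
  have hle : H.g θs x₀ ≤ᵐ[ν] H.g θs x := hx'.mono fun y hy => tsub_eq_zero_iff_le.1 hy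
  exact (ae_eq_of_ae_le_of_lintegral_le hle (by simp [H.lintegral_g]) (hgm x).aemeasurable
    (by simp [H.lintegral_g])).symm

/-- The density at `x₀` is made nonzero and finite everywhere by a change on a `ν`-null set. The set
`N` consists of the states from which an exceptional emission is reached with positive probability
at some time `k ≥ 0`; it is null by invariance, and a chain outside it almost surely cannot enter
it. -/
theorem exists_constEmission {θs : Θ} {ρ : Measure X} (hρ : (H.QX θs).Invariant ρ)
    (hg : ∀ x, ∀ᵐ y ∂ν, 0 < H.g θs x y) {x₀ : X}
    (h : ∀ᵐ x ∂ρ, H.g θs x =ᵐ[ν] H.g θs x₀) :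
    ∃ gs N, H.ConstEmission θs ρ gs N := by
  set gs : Y → ℝ≥0∞ := fun y =>
    if H.g θs x₀ y ∈ ({0, ⊤} : Set ℝ≥0∞) then 1 else H.g θs x₀ y with hgs
  have hgm : ∀ x, Measurable (H.g θs x) := H.measurable_g_left θs
  have hgsm : Measurable gs := Measurable.ite
    ((hgm x₀) (Set.toFinite _).measurableSet) measurable_const (hgm x₀)
  have hgsg : H.g θs x₀ =ᵐ[ν] gs := by
    filter_upwards [hg x₀, ae_lt_top (hgm x₀) (by simp [H.lintegral_g])] with y h1 h2
    simp [hgs, h1.ne', h2.ne]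
  set N₀ : Set X := {x | ν {y | H.g θs x y ≠ gs y} ≠ 0} with hN₀
  have hset : MeasurableSet {p : X × Y | H.g θs p.1 p.2 ≠ gs p.2} :=
    (measurableSet_eq_fun (H.measurable_g θs) (hgsm.comp measurable_snd)).compl
  have hN₀m : MeasurableSet N₀ :=
    (measurable_measure_prodMk_left hset) (measurableSet_singleton 0).compl
  set N : Set X := ⋃ k : ℕ, {x | (H.QX θs ^ k) x N₀ ≠ 0} with hN
  have hpm : ∀ k : ℕ, MeasurableSet {x | (H.QX θs ^ k) x N₀ ≠ 0} := fun k =>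
    (Kernel.measurable_coe _ hN₀m) (measurableSet_singleton 0).compl
  refine ⟨gs, N, hgsm, fun y => ?_, fun y => ?_, ⟨?_⟩, MeasurableSet.iUnion hpm, ?_, ?_, ?_⟩
  · by_cases hy : H.g θs x₀ y ∈ ({0, ⊤} : Set ℝ≥0∞)
    · simp only [hgs, hy, if_true]; exact one_ne_zero
    · simp only [hgs, hy, if_false]; exact fun h0 => hy (Or.inl h0)
  · by_cases hy : H.g θs x₀ y ∈ ({0, ⊤} : Set ℝ≥0∞)
    · simp only [hgs, hy, if_true]; exact ENNReal.one_ne_top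
    · simp only [hgs, hy, if_false]; exact fun h0 => hy (Or.inr h0)
  · rw [withDensity_apply _ MeasurableSet.univ, Measure.restrict_univ,
      ← lintegral_congr_ae hgsg, H.lintegral_g]
  · have h0 : ρ N₀ = 0 := by
      rw [measure_eq_zero_iff_ae_notMem]
      filter_upwards [h] with x hx hxN
      exact hxN (hx.trans hgsg)
    refine measure_iUnion_null fun k => ?_
    have hk : ρ.bind (H.QX θs ^ k) N₀ = 0 := by
      rw [(H.invariant_pow θs hρ k).def]; exact h0
    rw [Measure.bind_apply hN₀m (Kernel.aemeasurable _),
      lintegral_eq_zero_iff (Kernel.measurable_coe _ hN₀m)] at hk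
    exact hk
  · intro x hx
    refine measure_iUnion_null fun k => ?_
    have hk : (H.QX θs ^ (k + 1)) x N₀ = 0 := by
      by_contra hne
      exact hx (Set.mem_iUnion.2 ⟨k + 1, hne⟩)
    rw [pow_succ] at hk
    change ((H.QX θs ^ k) ∘ₖ H.QX θs) x N₀ = 0 at hk
    rw [Kernel.comp_apply' _ _ _ hN₀m, lintegral_eq_zero_iff (Kernel.measurable_coe _ hN₀m)] at hk
    exact hk
  · intro x hx
    have h0 : (H.QX θs ^ 0) x N₀ = 0 := by
      by_contra hne
      exact hx (Set.mem_iUnion.2 ⟨0, hne⟩)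
    rw [pow_zero] at h0
    change Kernel.id x N₀ = 0 at h0
    rw [Kernel.id_apply, Measure.dirac_apply' _ hN₀m] at h0
    have hxN : x ∉ N₀ := fun hxN => by simp [hxN] at h0
    exact not_not.1 hxN

/-- For `ρ`-almost every `x` the density `g_θs(x, ·)` is `gs`, so the integral over `x` is that of a
constant; Tonelli does the rest. -/
theorem ConstEmission.lintegral_cost {H : M.HMM} {θs : Θ} {ρ : Measure X}
    [IsProbabilityMeasure ρ] {gs : Y → ℝ≥0∞} {N : Set X} (C : H.ConstEmission θs ρ gs N) (θ : Θ)
    (σ : Measure X) [IsProbabilityMeasure σ] :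
    ∫⁻ y, ∫⁻ x, H.cost θ gs x y ∂σ ∂(ν.withDensity gs)
      = ∫⁻ p, H.emissionCost θs θ p ∂(ρ.prod σ) := by
  have hcost := H.measurable_cost θ C.measurable_gs
  have hc' : Measurable fun p : Y × X => H.cost θ gs p.2 p.1 :=
    hcost.comp (by fun_prop : Measurable fun p : Y × X => (p.2, p.1))
  have h1 : ∀ᵐ x ∂ρ, ∫⁻ x', H.emissionCost θs θ (x, x') ∂σ
      = ∫⁻ y, ∫⁻ x, H.cost θ gs x y ∂σ ∂(ν.withDensity gs) := by
    filter_upwards [measure_eq_zero_iff_ae_notMem.1 C.null] with x hx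
    have h2 : ∀ x', H.emissionCost θs θ (x, x') = ∫⁻ y, gs y * H.cost θ gs x' y ∂ν := by
      intro x'
      refine lintegral_congr_ae ?_
      filter_upwards [C.emission x hx] with y hy
      simp [hy, cost]
    simp_rw [h2]
    rw [lintegral_lintegral_swap, lintegral_withDensity_eq_lintegral_mul _ C.measurable_gs
      hc'.lintegral_prod_right']
    · refine lintegral_congr fun y => ?_
      rw [lintegral_const_mul _ (H.measurable_cost_left θ gs y)]
      rfl
    · exact ((C.measurable_gs.comp measurable_snd).mul hcost).aemeasurable
  rw [lintegral_prod _ (H.measurable_emissionCost θs θ).aemeasurable, lintegral_congr_ae h1]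
  simp

end HMM

end FDPOMM

end BayesPOMM

/-! ### Countable selection and adapted hitting schemes. -/

namespace BayesPOMM

/-- A measurable set with sections of positive measure has, up to a null set, a section taking
countably many values. -/
theorem exists_seq_mem_of_measure_ne_zero {T E : Type*} [MeasurableSpace T] [MeasurableSpace E]
    [Nonempty T] (lam : Measure T) [IsFiniteMeasure lam] (P : Measure E) [SFinite P]
    {B : Set (T × E)} (hB : MeasurableSet B) :
    ∃ s : ℕ → T, ∀ᵐ e ∂P, lam {t | (t, e) ∈ B} ≠ 0 → ∃ k, (s k, e) ∈ B := by
  by_cases h0 : lam = 0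
  · exact ⟨fun _ => Classical.arbitrary T, ae_of_all _ fun e he => absurd (by simp [h0]) he⟩
  have hu : lam Set.univ ≠ 0 := fun h => h0 (Measure.measure_univ_eq_zero.1 h)
  set m : Measure T := (lam Set.univ)⁻¹ • lam with hm
  have : IsProbabilityMeasure m :=
    ⟨by simp [hm, ENNReal.inv_mul_cancel hu (measure_ne_top lam _)]⟩
  -- Candidates are drawn independently from the normalised measure. For each `e` a section of
  -- positive mass is almost surely hit, and Fubini then yields one deterministic sequence that
  -- works for almost every `e`.
  set D := Measure.infinitePi fun _ : ℕ => m with hD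
  have hsec : ∀ e, MeasurableSet {t | (t, e) ∈ B} := fun e => measurable_prodMk_right hB
  have hTm : MeasurableSet {p : (ℕ → T) × E | lam {t | (t, p.2) ∈ B} ≠ 0 → ∃ k, (p.1 k, p.2) ∈ B} := by
    have h1 : MeasurableSet {p : (ℕ → T) × E | lam {t | (t, p.2) ∈ B} = 0} :=
      ((measurable_measure_prodMk_right hB).comp measurable_snd) (measurableSet_singleton 0)
    have h2 : MeasurableSet {p : (ℕ → T) × E | ∃ k, (p.1 k, p.2) ∈ B} := by
      have : {p : (ℕ → T) × E | ∃ k, (p.1 k, p.2) ∈ B}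
          = ⋃ k, (fun p : (ℕ → T) × E => (p.1 k, p.2)) ⁻¹' B := by ext; simp
      rw [this]
      exact MeasurableSet.iUnion fun k => (by fun_prop : Measurable fun p : (ℕ → T) × E =>
        (p.1 k, p.2)) hB
    convert! h1.union h2 using 1
    ext p
    simp only [Set.mem_ofPred_eq, Set.mem_union]
    tauto
  have hT : ∀ e, ∀ᵐ s ∂D, lam {t | (t, e) ∈ B} ≠ 0 → ∃ k, (s k, e) ∈ B := by
    intro e
    by_cases he : lam {t | (t, e) ∈ B} = 0
    · exact ae_of_all _ fun s h => absurd he h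
    have hlt : m {t | (t, e) ∈ B}ᶜ < 1 := by
      rw [prob_compl_eq_one_sub (hsec e)]
      refine ENNReal.sub_lt_self ENNReal.one_ne_top one_ne_zero ?_
      rw [hm, Measure.smul_apply, smul_eq_mul]
      exact mul_ne_zero (ENNReal.inv_ne_zero.2 (measure_ne_top lam _)) he
    have hz : D {s | ∀ k, (s k, e) ∉ B} = 0 := by
      refine le_antisymm (ge_of_tendsto' (ENNReal.tendsto_pow_atTop_nhds_zero_of_lt_one hlt)
        fun n => ?_) zero_le
      have hpi := Measure.infinitePi_pi (fun _ : ℕ => m) (s := Finset.range n)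
        (t := fun _ => {t | (t, e) ∈ B}ᶜ) fun _ _ => (hsec e).compl
      rw [Finset.prod_const, Finset.card_range] at hpi
      rw [← hpi]
      exact measure_mono fun s hs k _ => hs k
    filter_upwards [measure_eq_zero_iff_ae_notMem.1 hz] with s hs _
    simpa using hs
  have h := (Measure.ae_ae_comm (μ := D) (ν := P) hTm).2 (ae_of_all _ hT)
  exact h.exists

/-- An exponential lower bound, in terms of extended real logarithms. -/
theorem inv_mul_log_add_le {n : ℕ} (hn : 1 ≤ n) {p u : ℝ≥0∞} {a : ℝ} (hp0 : p ≠ 0) (hpt : p ≠ ⊤)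
    (h : ENNReal.ofReal (Real.exp (n * a)) * p ≤ u) :
    (((n : ℝ)⁻¹ : ℝ) : EReal) * ENNReal.log p + (a : EReal)
      ≤ (((n : ℝ)⁻¹ : ℝ) : EReal) * ENNReal.log u := by
  have hn' : (0 : ℝ) < n := by exact_mod_cast hn
  have hnE : (0 : EReal) ≤ (((n : ℝ)⁻¹ : ℝ) : EReal) := by
    exact_mod_cast (inv_pos.2 hn').le
  refine le_trans (le_of_eq ?_) (mul_le_mul_of_nonneg_left (ENNReal.log_monotone h) hnE)
  obtain ⟨q, hq, rfl⟩ : ∃ q : ℝ, 0 < q ∧ p = ENNReal.ofReal q :=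
    ⟨p.toReal, ENNReal.toReal_pos hp0 hpt, (ENNReal.ofReal_toReal hpt).symm⟩
  rw [← ENNReal.ofReal_mul (Real.exp_nonneg _), ENNReal.log_ofReal_of_pos hq,
    ENNReal.log_ofReal_of_pos (by positivity), ← EReal.coe_mul, ← EReal.coe_mul, ← EReal.coe_add]
  congr 1
  rw [Real.log_mul (Real.exp_ne_zero _) hq.ne', Real.log_exp]
  field_simp
  ring

theorem exists_tendsto_zero_mul_le {p u : ℕ → ℝ≥0∞} (hp0 : ∀ n, p n ≠ 0) (hpt : ∀ n, p n ≠ ⊤)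
    (hu0 : ∀ n, u n ≠ 0) (hut : ∀ n, u n ≠ ⊤)
    (h : ∀ δ : ℝ, 0 < δ → ∀ᶠ n : ℕ in atTop, ENNReal.ofReal (Real.exp (-(δ * n))) * p n ≤ u n) :
    ∃ a : ℕ → ℝ, Tendsto a atTop (𝓝 0) ∧
      ∀ n : ℕ, 1 ≤ n → ENNReal.ofReal (Real.exp (n * a n)) * p n ≤ u n := by
  have hpos : ∀ n, 0 < (p n).toReal := fun n => ENNReal.toReal_pos (hp0 n) (hpt n)
  have hupos : ∀ n, 0 < (u n).toReal := fun n => ENNReal.toReal_pos (hu0 n) (hut n)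
  set r : ℕ → ℝ := fun n => Real.log ((u n).toReal / (p n).toReal) with hr
  have hiff : ∀ n (b : ℝ), ENNReal.ofReal (Real.exp b) * p n ≤ u n ↔ b ≤ r n := by
    intro n b
    rw [← ENNReal.ofReal_toReal (hpt n), ← ENNReal.ofReal_toReal (hut n),
      ← ENNReal.ofReal_mul (Real.exp_nonneg _), ENNReal.ofReal_le_ofReal_iff (hupos n).le,
      ← le_div_iff₀ (hpos n), hr, ← Real.le_log_iff_exp_le (div_pos (hupos n) (hpos n))]
  -- Only a lower bound on the normalised log-ratio is available; capping it at `0` forces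
  -- convergence and preserves the inequality.
  refine ⟨fun n => min 0 ((n : ℝ)⁻¹ * r n), ?_, fun n hn => ?_⟩
  · rw [Metric.tendsto_atTop']
    intro ε hε
    obtain ⟨n₀, hn₀⟩ := eventually_atTop.1 (h (ε / 2) (by positivity))
    refine ⟨n₀, fun n hn => ?_⟩
    have hn' : (0 : ℝ) < n := by exact_mod_cast (Nat.zero_le n₀).trans_lt hn
    have h1 := (hiff n _).1 (hn₀ n hn.le)
    have h2 : -(ε / 2) ≤ (n : ℝ)⁻¹ * r n := by
      rw [inv_mul_eq_div, le_div_iff₀ hn']; linarith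
    rw [Real.dist_eq, sub_zero, abs_of_nonpos (min_le_left _ _)]
    have h3 : -(ε / 2) ≤ min 0 ((n : ℝ)⁻¹ * r n) := le_min (by linarith) h2
    linarith
  · rw [hiff]
    have hn' : (0 : ℝ) < n := by exact_mod_cast hn
    calc (n : ℝ) * min 0 ((n : ℝ)⁻¹ * r n) ≤ n * ((n : ℝ)⁻¹ * r n) := by
          gcongr; exact min_le_right _ _
      _ = r n := by field_simp

section AdaptiveSelection

variable {Y T : Type*} [MeasurableSpace Y] [MeasurableSpace T]

/-- The first `n` terms of a sequence. -/
def word (n : ℕ) (y : ℕ → Y) : Fin n → Y := fun i => y i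

@[fun_prop]
theorem measurable_word (n : ℕ) : Measurable (word n : (ℕ → Y) → Fin n → Y) := by
  unfold word; fun_prop

/-- The σ-field generated by the first `n` terms of a sequence. -/
abbrev wordField (Y : Type*) [MeasurableSpace Y] (n : ℕ) : MeasurableSpace (ℕ → Y) :=
  MeasurableSpace.comap (word n) inferInstance

theorem wordField_mono {m n : ℕ} (h : m ≤ n) : wordField Y m ≤ wordField Y n := by
  refine Measurable.comap_le ((@measurable_pi_iff _ _ _ (wordField Y n) _ _).2 fun i => ?_)
  exact (measurable_pi_apply (⟨i, i.2.trans_le h⟩ : Fin n)).comp (comap_measurable (word n))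

open Classical in
/-- The number of times `k < n` at which the sequence `y` has hit the adapted target `hit k`, the
target being changed after each hit. -/
noncomputable def hitCount (hit : (n : ℕ) → ℕ → Set (Fin n → Y)) : ℕ → (ℕ → Y) → ℕ
  | 0, _ => 0
  | n + 1, y => if word n y ∈ hit n (hitCount hit n y) then hitCount hit n y + 1
      else hitCount hit n y

variable (hit : (n : ℕ) → ℕ → Set (Fin n → Y))

theorem measurable_hitCount (hhit : ∀ n j, MeasurableSet (hit n j)) (n : ℕ) :
    Measurable[wordField Y n] (hitCount hit n) := by
  classical
  induction n with
  | zero => exact measurable_const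
  | succ n ih =>
    have hf : Measurable fun p : ℕ × (Fin n → Y) => if p.2 ∈ hit n p.1 then p.1 + 1 else p.1 :=
      measurable_from_prod_countable_right fun j =>
        Measurable.ite (hhit n j) (measurable_const (a := j + 1)) (measurable_const (a := j))
    have h : Measurable[wordField Y n] fun y => (hitCount hit n y, word n y) :=
      ih.prodMk (comap_measurable (word n))
    exact (hf.comp h).mono (wordField_mono (Nat.le_succ n)) le_rfl

open Classical in
/-- The adapted sequence which selects `sel` at the hitting times, and `t₀` otherwise. -/
noncomputable def hitSelect (sel : (n : ℕ) → ℕ → (Fin n → Y) → T) (t₀ : T) (n : ℕ) (y : ℕ → Y) : T :=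
  if word n y ∈ hit n (hitCount hit n y) then sel n (hitCount hit n y) (word n y) else t₀

theorem measurable_hitSelect (hhit : ∀ n j, MeasurableSet (hit n j))
    {sel : (n : ℕ) → ℕ → (Fin n → Y) → T} (hsel : ∀ n j, Measurable (sel n j)) (t₀ : T) (n : ℕ) :
    Measurable[wordField Y n] (hitSelect hit sel t₀ n) := by
  classical
  have hf : Measurable fun p : ℕ × (Fin n → Y) => if p.2 ∈ hit n p.1 then sel n p.1 p.2 else t₀ :=
    measurable_from_prod_countable_right fun j =>
      Measurable.ite (hhit n j) (hsel n j) measurable_const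
  have h : Measurable[wordField Y n] fun y => (hitCount hit n y, word n y) :=
    (measurable_hitCount hit hhit n).prodMk (comap_measurable (word n))
  exact hf.comp h

theorem monotone_hitCount (y : ℕ → Y) : Monotone fun n => hitCount hit n y := by
  refine monotone_nat_of_le_succ fun n => ?_
  simp only [hitCount]
  split_ifs <;> omega

theorem eventually_notMem_of_eventually_eq {y : ℕ → Y} {j : ℕ}
    (h : ∀ᶠ n in atTop, hitCount hit n y = j) : ∀ᶠ n in atTop, word n y ∉ hit n j := by
  obtain ⟨n₀, hn₀⟩ := eventually_atTop.1 h
  filter_upwards [eventually_ge_atTop n₀] with n hn hmem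
  have h1 := hn₀ n hn
  have h2 := hn₀ (n + 1) (by omega)
  rw [hitCount, h1, if_pos hmem] at h2
  omega

theorem eventually_eq_or_tendsto_hitCount (y : ℕ → Y) :
    (∃ j, ∀ᶠ n in atTop, hitCount hit n y = j) ∨
      Tendsto (fun n => hitCount hit n y) atTop atTop := by
  rcases tendsto_atTop_of_monotone (monotone_hitCount hit y) with h | ⟨l, hl⟩
  · exact Or.inr h
  · refine Or.inl ⟨l, ?_⟩
    rw [nhds_discrete, tendsto_pure] at hl
    exact hl

/-- Without hits the count, and with it the target, stays fixed. -/
theorem exists_eventually_notMem {y : ℕ → Y}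
    (h : ∀ᶠ n in atTop, word n y ∉ hit n (hitCount hit n y)) :
    ∃ j, ∀ᶠ n in atTop, word n y ∉ hit n j := by
  obtain ⟨n₀, hn₀⟩ := eventually_atTop.1 h
  refine ⟨hitCount hit n₀ y, eventually_notMem_of_eventually_eq hit ?_⟩
  filter_upwards [eventually_ge_atTop n₀] with n hn
  induction n, hn using Nat.le_induction with
  | base => rfl
  | succ n hn ih => rw [hitCount, if_neg (hn₀ n hn), ih]

-- Either the count stabilises, hits cease and the rate is eventually `a`; or the count diverges and
-- both branches tend to zero.
open Classical in
theorem tendsto_hit_rate {y : ℕ → Y} {a : ℕ → ℝ} (ha : Tendsto a atTop (𝓝 0)) :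
    Tendsto (fun n => if word n y ∈ hit n (hitCount hit n y)
      then -(1 / ((hitCount hit n y : ℝ) + 1)) else a n) atTop (𝓝 0) := by
  rcases eventually_eq_or_tendsto_hitCount hit y with ⟨j, hj⟩ | h
  · refine ha.congr' ?_
    filter_upwards [hj, eventually_notMem_of_eventually_eq hit hj] with n h1 h2
    rw [h1, if_neg h2]
  · have h1 : Tendsto (fun n => -(1 / ((hitCount hit n y : ℝ) + 1))) atTop (𝓝 0) := by
      have := (tendsto_one_div_add_atTop_nhds_zero_nat (𝕜 := ℝ)).comp h
      simpa using this.neg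
    exact Tendsto.if' h1 ha

end AdaptiveSelection

/-! ### Exponential smallness of the likelihood away from the true parameter. -/

namespace FDPOMM

variable {Θ X Y : Type*} [MetricSpace Θ] [CompactSpace Θ] [MeasurableSpace Θ] [BorelSpace Θ]
  [MeasurableSpace X] [MeasurableSpace Y]
  {μ : Measure X} {ν : Measure Y} [SigmaFinite μ] [SigmaFinite ν] {M : FDPOMM Θ X Y μ ν}

/-- If approximate maximum likelihood estimators are consistent, then the integrated likelihood over
a closed set which does not contain the true parameter is exponentially small. -/
theorem ApproxMLEConsistent.ae_eventually_setLIntegral_le {θs : Θ} {π η : Measure (X × Y)}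
    [IsProbabilityMeasure π] [IsProbabilityMeasure η] (hMLE : M.ApproxMLEConsistent θs π η)
    (lam : Measure Θ) [IsFiniteMeasure lam] {gs : Y → ℝ≥0∞} (hgs : Measurable gs)
    (hgs0 : ∀ y, gs y ≠ 0) (hgst : ∀ y, gs y ≠ ⊤)
    (hlik : ∀ᵐ y ∂((M.law θs π).map obsSeq), ∀ n,
      M.likSeq θs π n y = ∏ i ∈ Finset.range n, gs (y i))
    (hfb0 : ∀ᵐ y ∂((M.law θs π).map obsSeq), ∀ n, M.likSeq θs η n y ≠ 0)
    (hfbt : ∀ᵐ y ∂((M.law θs π).map obsSeq), ∀ n, M.likSeq θs η n y < ⊤)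
    (hfb : ∀ δ : ℝ, 0 < δ → ∀ᵐ y ∂((M.law θs π).map obsSeq), ∀ᶠ n : ℕ in atTop,
      ENNReal.ofReal (Real.exp (-(δ * n))) * ∏ i ∈ Finset.range n, gs (y i) ≤ M.likSeq θs η n y)
    {A : Set Θ} (hA : IsClosed A) (hθA : θs ∉ A) :
    ∀ᵐ y ∂((M.law θs π).map obsSeq), ∃ j : ℕ, ∀ᶠ n : ℕ in atTop,
      ∫⁻ θ in A, M.likSeq θ η n y ∂lam ≤
        ENNReal.ofReal (Real.exp (n * -(1 / ((j : ℝ) + 1)))) *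
          (∏ i ∈ Finset.range n, gs (y i)) * lam A := by
  classical
  set P := (M.law θs π).map obsSeq with hP
  have : IsProbabilityMeasure P := Measure.isProbabilityMeasure_map (by fun_prop)
  have : Nonempty Θ := ⟨θs⟩
  set B : (n : ℕ) → ℕ → Set (Θ × (Fin n → Y)) := fun n j => {p | p.1 ∈ A ∧
    ENNReal.ofReal (Real.exp (n * -(1 / ((j : ℝ) + 1)))) * ∏ i, gs (p.2 i)
      < M.likelihood p.1 η p.2} with hBdef
  have hB : ∀ n j, MeasurableSet (B n j) := fun n j =>
    (measurable_fst hA.measurableSet).inter (measurableSet_lt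
      (measurable_const.mul (Finset.measurable_prod _ fun i _ =>
        hgs.comp ((measurable_pi_apply i).comp measurable_snd))) (M.measurable_likelihood η n))
  choose s hs using fun n j =>
    exists_seq_mem_of_measure_ne_zero lam (P.map (word n)) (hB n j)
  set hit : (n : ℕ) → ℕ → Set (Fin n → Y) := fun n j => {w | ∃ k, (s n j k, w) ∈ B n j} with hhitdef
  have hhit1 : ∀ n j k, MeasurableSet {w | (s n j k, w) ∈ B n j} := fun n j k =>
    measurable_prodMk_left (hB n j)
  have hhit : ∀ n j, MeasurableSet (hit n j) := fun n j => by
    have : hit n j = ⋃ k, {w | (s n j k, w) ∈ B n j} := by ext; simp [hhitdef]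
    rw [this]
    exact MeasurableSet.iUnion fun k => hhit1 n j k
  have hex : ∀ n j w, ∃ k, (s n j k, w) ∈ B n j ∨ w ∉ hit n j := by
    intro n j w
    by_cases hw : w ∈ hit n j
    · obtain ⟨k, hk⟩ := hw
      exact ⟨k, Or.inl hk⟩
    · exact ⟨0, Or.inr hw⟩
  -- The first successful candidate is selected. The alternative `w ∉ hit n j` only makes the search
  -- terminate everywhere.
  set sel : (n : ℕ) → ℕ → (Fin n → Y) → Θ := fun n j w => s n j (Nat.find (hex n j w)) with hseldef
  have hsel : ∀ n j, Measurable (sel n j) := fun n j =>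
    Measurable.find (f := fun k _ => s n j k) (p := fun k w => (s n j k, w) ∈ B n j ∨ w ∉ hit n j)
      (fun k => measurable_const) (fun k => (hhit1 n j k).union (hhit n j).compl) (hex n j)
  have hselB : ∀ n j w, w ∈ hit n j → (sel n j w, w) ∈ B n j := fun n j w hw =>
    (Nat.find_spec (hex n j w)).resolve_right (not_not.2 hw)
  set θhat : ℕ → (ℕ → X × Y) → Θ := fun n ω => hitSelect hit sel θs n (obsSeq ω) with hθhat
  have hobs : ∀ n, (fun ω : ℕ → X × Y => word n (obsSeq ω)) = obs n := fun n => rfl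
  have hmeas : ∀ n, 1 ≤ n → Measurable[obsField X Y n] (θhat n) := by
    intro n _
    have h1 : Measurable[obsField X Y n, wordField Y n] (obsSeq : (ℕ → X × Y) → ℕ → Y) := by
      rw [measurable_iff_comap_le, MeasurableSpace.comap_comp]
      exact le_rfl
    exact (measurable_hitSelect hit hhit hsel θs n).comp h1
  have hK : ∀ n, 1 ≤ n → ∀ ω, θhat n ω ∈ A ∪ {θs} := by
    intro n _ ω
    simp only [hθhat, hitSelect]
    split_ifs with h
    · exact Or.inl (hselB _ _ _ h).1
    · exact Or.inr rfl
  have hfb' : ∀ᵐ y ∂P, ∀ k : ℕ, ∀ᶠ n : ℕ in atTop,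
      ENNReal.ofReal (Real.exp (-(1 / ((k : ℝ) + 1) * n))) * ∏ i ∈ Finset.range n, gs (y i)
        ≤ M.likSeq θs η n y := ae_all_iff.2 fun k => hfb _ (by positivity)
  have hfall : ∀ᵐ y ∂P, ∃ a : ℕ → ℝ, Tendsto a atTop (𝓝 0) ∧ ∀ n : ℕ, 1 ≤ n →
      ENNReal.ofReal (Real.exp (n * a n)) * ∏ i ∈ Finset.range n, gs (y i)
        ≤ M.likSeq θs η n y := by
    filter_upwards [hfb0, hfbt, hfb'] with y h0 ht h
    refine exists_tendsto_zero_mul_le (fun n => Finset.prod_ne_zero_iff.2 fun i _ => hgs0 _)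
      (fun n => ENNReal.prod_ne_top fun i _ => hgst _) h0 (fun n => (ht n).ne) fun δ hδ => ?_
    obtain ⟨k, hk⟩ := exists_nat_one_div_lt hδ
    filter_upwards [h k] with n hn
    refine le_trans ?_ hn
    gcongr
  -- A rate for the fallback value `θs`, whose likelihood is started from `η` and not from `π`; the
  -- default `0` is taken only on a null set. No measurability in `y` is required of the error
  -- sequence.
  set a : (ℕ → Y) → ℕ → ℝ := fun y => if h : ∃ a : ℕ → ℝ, Tendsto a atTop (𝓝 0) ∧ ∀ n : ℕ, 1 ≤ n →
      ENNReal.ofReal (Real.exp (n * a n)) * ∏ i ∈ Finset.range n, gs (y i)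
        ≤ M.likSeq θs η n y then h.choose else 0 with hadef
  set ε : ℕ → (ℕ → X × Y) → ℝ := fun n ω =>
    if word n (obsSeq ω) ∈ hit n (hitCount hit n (obsSeq ω))
      then -(1 / ((hitCount hit n (obsSeq ω) : ℝ) + 1)) else a (obsSeq ω) n with hε
  have hconv := hMLE (A ∪ {θs}) (hA.isCompact.union isCompact_singleton) (Or.inr rfl) θhat ε
    hmeas hK (by
      filter_upwards [ae_of_ae_map (by fun_prop) hlik, ae_of_ae_map (by fun_prop) hfall]
        with ω h1 h2
      have ha : a (obsSeq ω) = h2.choose := dif_pos h2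
      refine ⟨fun n hn => ?_, ?_⟩
      · rw [likelihood_obs, likelihood_obs, h1]
        refine inv_mul_log_add_le hn (Finset.prod_ne_zero_iff.2 fun i _ => hgs0 _)
          (ENNReal.prod_ne_top fun i _ => hgst _) ?_
        by_cases hh : word n (obsSeq ω) ∈ hit n (hitCount hit n (obsSeq ω))
        · simp only [hε, hθhat, hitSelect, hh, if_true]
          have h3 := (hselB _ _ _ hh).2.le
          rw [Finset.prod_range]
          exact h3
        · simp only [hε, hθhat, hitSelect, hh, if_false, ha]
          exact h2.choose_spec.2 n hn
      · simp only [hε]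
        refine tendsto_hit_rate hit ?_
        rw [ha]
        exact h2.choose_spec.1)
  have hlikm : ∀ n, Measurable fun y => ∫⁻ θ in A, M.likSeq θ η n y ∂lam := fun n =>
    ((M.measurable_likSeq η n).comp (by fun_prop : Measurable fun p : (ℕ → Y) × Θ =>
      (p.2, p.1))).lintegral_prod_right'
  have hprodm : ∀ n : ℕ, Measurable fun y : ℕ → Y => ∏ i ∈ Finset.range n, gs (y i) := fun n =>
    Finset.measurable_prod _ fun i _ => hgs.comp (measurable_pi_apply i)
  have hgoal : MeasurableSet {y : ℕ → Y | ∃ j : ℕ, ∀ᶠ n : ℕ in atTop,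
      ∫⁻ θ in A, M.likSeq θ η n y ∂lam ≤
        ENNReal.ofReal (Real.exp (n * -(1 / ((j : ℝ) + 1)))) *
          (∏ i ∈ Finset.range n, gs (y i)) * lam A} := by
    simp only [eventually_atTop, Set.ofPred_exists, Set.ofPred_forall]
    refine MeasurableSet.iUnion fun j => MeasurableSet.iUnion fun n₀ => MeasurableSet.iInter fun n =>
      MeasurableSet.iInter fun _ => measurableSet_le (hlikm n) ?_
    exact (measurable_const.mul (hprodm n)).mul measurable_const
  have hs' : ∀ᵐ y ∂P, ∀ n j, lam {θ | (θ, word n y) ∈ B n j} ≠ 0 → word n y ∈ hit n j :=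
    ae_all_iff.2 fun n => ae_all_iff.2 fun j => ae_of_ae_map (by fun_prop) (hs n j)
  refine (ae_map_iff (by fun_prop) hgoal).2 ?_
  filter_upwards [hconv, ae_of_ae_map (by fun_prop) hs'] with ω hω hsel'
  -- Every hit places the estimator in `A`, while consistency drives it into the open complement.
  have hno : ∀ᶠ n in atTop, word n (obsSeq ω) ∉ hit n (hitCount hit n (obsSeq ω)) := by
    filter_upwards [hω.eventually (hA.isOpen_compl.mem_nhds hθA)] with n hn hh
    refine hn ?_
    simp only [hθhat, hitSelect, hh, if_true]
    exact (hselB _ _ _ hh).1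
  obtain ⟨j, hj⟩ := exists_eventually_notMem hit hno
  refine ⟨j, ?_⟩
  filter_upwards [hj] with n hn
  -- A target of positive prior mass would have been hit by the countable selection, so almost every
  -- parameter of `A` is below the threshold.
  have h0 : lam {θ | (θ, word n (obsSeq ω)) ∈ B n j} = 0 := by
    by_contra hne
    exact hn (hsel' n j hne)
  rw [← setLIntegral_const]
  refine setLIntegral_mono_ae' hA.measurableSet ?_
  filter_upwards [measure_eq_zero_iff_ae_notMem.1 h0] with θ hθ hθA'
  by_contra hlt
  refine hθ ⟨hθA', ?_⟩
  rw [not_le, Finset.prod_range] at hlt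
  exact hlt

end FDPOMM

end BayesPOMM

/-! ### Averages over the prior, and weak convergence to a Dirac mass. -/

namespace BayesPOMM

/-- If for every `t` in a set of positive outer measure the functions `f n (t, ·)` eventually
dominate `b n` almost surely, then their averages eventually dominate a multiple of `b n`. -/
theorem ae_exists_mul_le_lintegral {T Ω : Type*} [MeasurableSpace T] [MeasurableSpace Ω]
    (lam : Measure T) [IsFiniteMeasure lam] (P : Measure Ω) [IsProbabilityMeasure P]
    {f : ℕ → T × Ω → ℝ≥0∞} (hf : ∀ n, Measurable (f n)) {b : ℕ → Ω → ℝ≥0∞}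
    (hb : ∀ n, Measurable (b n)) {S : Set T} (hS : 0 < lam S)
    (h : ∀ t ∈ S, ∀ᵐ y ∂P, ∀ᶠ n in atTop, b n y ≤ f n (t, y)) :
    ∀ᵐ y ∂P, ∃ c : ℝ≥0∞, c ≠ 0 ∧ c ≠ ⊤ ∧ ∀ᶠ n in atTop, c * b n y ≤ ∫⁻ t, f n (t, y) ∂lam := by
  have hE : MeasurableSet {p : T × Ω | ∀ᶠ n in atTop, b n p.2 ≤ f n p} := by
    simp only [eventually_atTop, Set.ofPred_exists, Set.ofPred_forall]
    exact MeasurableSet.iUnion fun n₀ => MeasurableSet.iInter fun n => MeasurableSet.iInter fun _ =>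
      measurableSet_le ((hb n).comp measurable_snd) (hf n)
  -- The set `S` need not be measurable; it is replaced by the measurable set of all parameters with
  -- the desired property.
  set S' : Set T := {t | P {y | ¬ ∀ᶠ n in atTop, b n y ≤ f n (t, y)} = 0} with hS'
  have hS'm : MeasurableSet S' :=
    (measurable_measure_prodMk_left (ν := P) hE.compl) (measurableSet_singleton 0)
  have hSS' : S ⊆ S' := fun t ht => h t ht
  have hpos : 0 < lam S' := hS.trans_le (measure_mono hSS')
  have hae : ∀ᵐ t ∂(lam.restrict S'), ∀ᵐ y ∂P, ∀ᶠ n in atTop, b n y ≤ f n (t, y) := by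
    filter_upwards [ae_restrict_mem hS'm] with t ht using ht
  have hae2 : ∀ᵐ y ∂P, ∀ᵐ t ∂(lam.restrict S'), ∀ᶠ n in atTop, b n y ≤ f n (t, y) :=
    (Measure.ae_ae_comm hE).1 hae
  filter_upwards [hae2] with y hy
  have hun : lam.restrict S' (⋃ n₀ : ℕ, {t | ∀ n, n₀ ≤ n → b n y ≤ f n (t, y)}) ≠ 0 := by
    have h1 : lam.restrict S' (⋃ n₀ : ℕ, {t | ∀ n, n₀ ≤ n → b n y ≤ f n (t, y)})
        = lam.restrict S' Set.univ := by
      refine measure_congr ?_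
      filter_upwards [hy] with t ht
      refine propext ⟨fun _ => trivial, fun _ => ?_⟩
      obtain ⟨n₀, hn₀⟩ := eventually_atTop.1 ht
      exact Set.mem_iUnion.2 ⟨n₀, hn₀⟩
    rw [h1, Measure.restrict_apply_univ]
    exact hpos.ne'
  obtain ⟨n₀, hn₀⟩ : ∃ n₀ : ℕ, lam {t | ∀ n, n₀ ≤ n → b n y ≤ f n (t, y)} ≠ 0 := by
    by_contra hcon
    push Not at hcon
    exact hun (Measure.restrict_le_self.absolutelyContinuous (measure_iUnion_null hcon))
  -- The constant is the mass of the parameters for which domination starts no later than `n₀`;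
  -- Markov's inequality concludes.
  refine ⟨_, hn₀, measure_ne_top lam _, ?_⟩
  filter_upwards [eventually_ge_atTop n₀] with n hn
  rw [mul_comm]
  refine le_trans ?_ (mul_meas_ge_le_lintegral
    ((hf n).comp (by fun_prop : Measurable fun t : T => (t, y))) (b n y))
  exact mul_le_mul_right (measure_mono fun t (ht : ∀ n, n₀ ≤ n → b n y ≤ f n (t, y)) => ht n hn) _

theorem tendsto_inv_mul_zero {c L : ℝ≥0∞} (hc0 : c ≠ 0) (hct : c ≠ ⊤) (hL : L ≠ ⊤)
    {δ : ℝ} (hδ : 0 < δ) {p D N : ℕ → ℝ≥0∞} (hp0 : ∀ n, p n ≠ 0) (hpt : ∀ n, p n ≠ ⊤)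
    (hD : ∀ᶠ n : ℕ in atTop, c * (ENNReal.ofReal (Real.exp (-(δ * n))) * p n) ≤ D n)
    (hN : ∀ᶠ n : ℕ in atTop, N n ≤ ENNReal.ofReal (Real.exp (n * -(2 * δ))) * p n * L) :
    Tendsto (fun n => (D n)⁻¹ * N n) atTop (𝓝 0) := by
  have he : Tendsto (fun n : ℕ => ENNReal.ofReal (Real.exp (-(δ * n)))) atTop (𝓝 0) := by
    rw [← ENNReal.ofReal_zero]
    refine ENNReal.tendsto_ofReal (Real.tendsto_exp_neg_atTop_nhds_zero.comp ?_)
    exact tendsto_natCast_atTop_atTop.const_mul_atTop hδ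
  have hlim : Tendsto (fun n : ℕ => c⁻¹ * L * ENNReal.ofReal (Real.exp (-(δ * n)))) atTop (𝓝 0) := by
    have := ENNReal.Tendsto.const_mul (a := c⁻¹ * L) he
      (Or.inr (ENNReal.mul_ne_top (ENNReal.inv_ne_top.2 hc0) hL))
    rwa [mul_zero] at this
  refine tendsto_of_tendsto_of_tendsto_of_le_of_le' tendsto_const_nhds hlim
    (Eventually.of_forall fun _ => zero_le) ?_
  filter_upwards [hD, hN] with n h1 h2
  set e := ENNReal.ofReal (Real.exp (-(δ * n))) with hedef
  have he0 : e ≠ 0 := by simp [hedef, Real.exp_pos]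
  have het : e ≠ ⊤ := ENNReal.ofReal_ne_top
  have hee : ENNReal.ofReal (Real.exp (n * -(2 * δ))) = e * e := by
    rw [hedef, ← ENNReal.ofReal_mul (Real.exp_pos _).le, ← Real.exp_add]
    ring_nf
  rw [hee] at h2
  calc (D n)⁻¹ * N n ≤ (c * (e * p n))⁻¹ * (e * e * p n * L) :=
        mul_le_mul' (ENNReal.inv_le_inv.2 h1) h2
    _ = (e * p n)⁻¹ * (e * p n) * (c⁻¹ * L * e) := by
        rw [ENNReal.mul_inv (Or.inl hc0) (Or.inl hct)]; ring
    _ = c⁻¹ * L * e := by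
        rw [ENNReal.inv_mul_cancel (mul_ne_zero he0 (hp0 n)) (ENNReal.mul_ne_top het (hpt n)),
          one_mul]

theorem eventuallyProbTendstoWeakly_dirac {T : Type*} [MetricSpace T] [MeasurableSpace T]
    [BorelSpace T] {m : ℕ → Measure T} (hm : ∀ᶠ n in atTop, IsProbabilityMeasure (m n)) (t : T)
    (h : ∀ r : ℕ, Tendsto (fun n => m n {s | 1 / ((r : ℝ) + 1) ≤ dist s t}) atTop (𝓝 0)) :
    EventuallyProbTendstoWeakly m ⟨Measure.dirac t, inferInstance⟩ := by
  classical
  obtain ⟨p, hp⟩ : ∃ p : ℕ → ProbabilityMeasure T, ∀ᶠ n in atTop, (p n : Measure T) = m n := by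
    refine ⟨fun n => if h : IsProbabilityMeasure (m n) then ⟨m n, h⟩
      else ⟨Measure.dirac t, inferInstance⟩, ?_⟩
    filter_upwards [hm] with n hn
    simp [hn]
  -- Portmanteau: an open set containing `t` has its complement in one of the sets `{s | 1/(r+1) ≤
  -- dist s t}`, whose mass vanishes.
  refine ⟨p, hp, tendsto_of_forall_isOpen_le_liminf' fun G hG => ?_⟩
  by_cases ht : t ∈ G
  · obtain ⟨ε, hε, hball⟩ := Metric.isOpen_iff.1 hG t ht
    obtain ⟨r, hr⟩ := exists_nat_one_div_lt hε
    have hlim : Tendsto (fun n => 1 - m n {s | 1 / ((r : ℝ) + 1) ≤ dist s t}) atTop (𝓝 1) := by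
      have := ENNReal.Tendsto.sub (tendsto_const_nhds (x := (1 : ℝ≥0∞))) (h r) (Or.inl ENNReal.one_ne_top)
      rwa [tsub_zero] at this
    refine (prob_le_one (μ := Measure.dirac t)).trans ?_
    rw [← hlim.liminf_eq]
    refine liminf_le_liminf ?_
    filter_upwards [hp] with n hn
    rw [tsub_le_iff_right, ← measure_univ (μ := (p n : Measure T)), ← hn]
    refine (measure_mono fun s _ => ?_).trans (measure_union_le _ _)
    rcases lt_or_ge (dist s t) (1 / ((r : ℝ) + 1)) with hs | hs
    · exact Or.inl (hball (hs.trans hr))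
    · exact Or.inr hs
  · have : (Measure.dirac t) G = 0 := by
      rw [Measure.dirac_apply' _ hG.measurableSet, Set.indicator_of_notMem ht]
    change (Measure.dirac t) G ≤ _
    rw [this]
    exact zero_le

namespace FDPOMM

variable {Θ X Y : Type*} [MeasurableSpace Θ] [MeasurableSpace X] [MeasurableSpace Y]
  {μ : Measure X} {ν : Measure Y} [SigmaFinite μ] [SigmaFinite ν]

theorem posterior_apply (M : FDPOMM Θ X Y μ ν) (lam : Measure Θ) (η : Measure (X × Y))
    {n : ℕ} (y : Fin n → Y) {A : Set Θ} (hA : MeasurableSet A) :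
    M.posterior lam η y A
      = (∫⁻ θ, M.likelihood θ η y ∂lam)⁻¹ * ∫⁻ θ in A, M.likelihood θ η y ∂lam := by
  rw [posterior, Measure.smul_apply, withDensity_apply _ hA, smul_eq_mul]

theorem isProbabilityMeasure_posterior (M : FDPOMM Θ X Y μ ν) (lam : Measure Θ)
    (η : Measure (X × Y)) {n : ℕ} (y : Fin n → Y) (h0 : ∫⁻ θ, M.likelihood θ η y ∂lam ≠ 0)
    (ht : ∫⁻ θ, M.likelihood θ η y ∂lam ≠ ⊤) : IsProbabilityMeasure (M.posterior lam η y) :=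
  ⟨by rw [posterior_apply _ _ _ _ MeasurableSet.univ, Measure.restrict_univ,
    ENNReal.inv_mul_cancel h0 ht]⟩

end FDPOMM

end BayesPOMM

/-! ### Posterior consistency. -/

theorem mainTheorem2 {Θ X Y : Type*} [MetricSpace Θ] [CompactSpace Θ] [MeasurableSpace Θ]
    [BorelSpace Θ] [MeasurableSpace X] [MeasurableSpace Y]
    (μ : Measure X) (ν : Measure Y) [SigmaFinite μ] [SigmaFinite ν]
    (M : BayesPOMM.FDPOMM Θ X Y μ ν) (θs : Θ)
    -- each transition kernel has a unique stationary distribution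
    (π : Θ → Measure (X × Y)) [∀ θ, IsProbabilityMeasure (π θ)]
    (hπ : ∀ θ, BayesPOMM.IsUniqueStationary (M.Q θ) (π θ))
    -- the prior, and the initial distribution used in the likelihood
    (lam : Measure Θ) [IsFiniteMeasure lam]
    (η : Measure (X × Y)) [IsProbabilityMeasure η]
    (hMLE : M.ApproxMLEConsistent θs (π θs) η)
    -- hidden Markov structure, with positive emission density
    (H : M.HMM)
    (hg : ∀ θ x, ∀ᵐ y ∂ν, 0 < H.g θ x y)
    (hKL : ∀ δ : ℝ, 0 < δ → 0 < lam {θ | H.emissionKL π θs θ ≤ ENNReal.ofReal δ})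
    (hTV : ∀ (θ : Θ) (ξ : Measure X) [IsProbabilityMeasure ξ],
      Tendsto (fun n : ℕ => BayesPOMM.tvNormSub (ξ.bind (H.QX θ ^ n)) (π θ).fst) atTop (𝓝 0)) :
    ∀ (ηs : Measure (X × Y)), IsProbabilityMeasure ηs →
      ∀ᵐ ω ∂(M.law θs ηs),
        BayesPOMM.EventuallyProbTendstoWeakly
          (fun n : ℕ => M.posterior lam η (BayesPOMM.obs n ω))
          ⟨Measure.dirac θs, inferInstance⟩ := by
  intro ηs _
  have hinv : ∀ θ, (H.QX θ).Invariant (π θ).fst := fun θ => H.invariant_fst θ (hπ θ).2.1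
  have hcost : ∀ τ : ℝ, 0 < τ → ∃ δ : ℝ, 0 < δ ∧ ∀ θ, H.emissionKL π θs θ ≤ ENNReal.ofReal δ →
      ∫⁻ p, H.emissionCost θs θ p ∂((π θs).fst.prod (π θ).fst) ≤ ENNReal.ofReal τ :=
    fun τ hτ => H.exists_emissionKL_imp hg π θs hτ
  obtain ⟨x₀, hx₀⟩ := H.exists_ae_g_eq (θs := θs) (ρ := (π θs).fst) (by
    intro τ hτ
    obtain ⟨δ, hδ, h⟩ := hcost τ hτ
    obtain ⟨θ, hθ⟩ := nonempty_of_measure_ne_zero (hKL δ hδ).ne'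
    exact ⟨θ, (π θ).fst, inferInstance, h θ hθ⟩)
  obtain ⟨gs, N, C⟩ := H.exists_constEmission (hinv θs) (hg θs) hx₀
  have := C.isProb
  have hP : (M.law θs (π θs)).map BayesPOMM.obsSeq = Measure.infinitePi (fun _ : ℕ => ν.withDensity gs) :=
    C.map_obsSeq (π θs) rfl
  have hfb : ∀ δ : ℝ, 0 < δ → ∀ᵐ y ∂((M.law θs (π θs)).map BayesPOMM.obsSeq), ∀ᶠ n : ℕ in atTop,
      ENNReal.ofReal (Real.exp (-(δ * n))) * ∏ i ∈ Finset.range n, gs (y i)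
        ≤ M.likSeq θs η n y := by
    intro δ hδ
    have h := C.ae_eventually_le_likSeq (hg θs) (hinv θs) η (hTV θs η.fst)
      (τ := δ / 5) (by positivity) (by rw [C.lintegral_cost_eq_zero]; exact zero_le)
    rw [mul_div_cancel₀ _ (by norm_num : (5 : ℝ) ≠ 0)] at h
    rwa [hP]
  have hden : ∀ᵐ y ∂((M.law θs (π θs)).map BayesPOMM.obsSeq), ∀ k : ℕ, ∃ c : ℝ≥0∞, c ≠ 0 ∧ c ≠ ⊤ ∧
      ∀ᶠ n : ℕ in atTop, c * (ENNReal.ofReal (Real.exp (-(1 / (2 * ((k : ℝ) + 1)) * n))) *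
        ∏ i ∈ Finset.range n, gs (y i)) ≤ ∫⁻ θ, M.likSeq θ η n y ∂lam := by
    refine ae_all_iff.2 fun k => ?_
    -- Half of the numerator's rate `1/(k+1)`, so that the denominator decays more slowly. The
    -- division by `5` below offsets the factor in `ae_eventually_le_likSeq`.
    set δ : ℝ := 1 / (2 * ((k : ℝ) + 1)) with hδdef
    have hδ : 0 < δ := by positivity
    obtain ⟨δ', hδ', h⟩ := hcost (δ / 5) (by positivity)
    rw [hP]
    refine BayesPOMM.ae_exists_mul_le_lintegral lam _ (M.measurable_likSeq η) (fun n => measurable_const.mul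
      (Finset.measurable_prod _ fun i _ => C.measurable_gs.comp (measurable_pi_apply i)))
      (hKL δ' hδ') fun θ hθ => ?_
    have h' := C.ae_eventually_le_likSeq (hg θ) (hinv θ) η (hTV θ η.fst)
      (τ := δ / 5) (by positivity) (by rw [C.lintegral_cost]; exact h θ hθ)
    rwa [mul_div_cancel₀ _ (by norm_num : (5 : ℝ) ≠ 0)] at h'
  have hnum : ∀ᵐ y ∂((M.law θs (π θs)).map BayesPOMM.obsSeq), ∀ r : ℕ, ∃ j : ℕ, ∀ᶠ n : ℕ in atTop,
      ∫⁻ θ in {θ | 1 / ((r : ℝ) + 1) ≤ dist θ θs}, M.likSeq θ η n y ∂lam ≤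
        ENNReal.ofReal (Real.exp (n * -(1 / ((j : ℝ) + 1)))) *
          (∏ i ∈ Finset.range n, gs (y i)) * lam {θ | 1 / ((r : ℝ) + 1) ≤ dist θ θs} := by
    refine ae_all_iff.2 fun r => hMLE.ae_eventually_setLIntegral_le lam C.measurable_gs C.gs_ne_zero
      C.gs_ne_top ?_ ?_ ?_ hfb (isClosed_le continuous_const (by fun_prop)) ?_
    · rw [hP]; exact C.ae_likSeq_eq_prod (hinv θs) rfl
    · rw [hP]
      filter_upwards [H.ae_g_ne_zero (gs := gs) (hg θs)] with y hy n
      rw [H.likSeq_eq]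
      exact H.lintegral_condLik_ne_zero θs hy n
    · rw [hP]; exact C.ae_likSeq_lt_top θs η
    · simp only [Set.mem_ofPred_eq, dist_self, not_le]
      positivity
  -- All almost sure statements so far concern the stationary law of the observations; they are
  -- carried to `ηs` here, as `N` is stationary-null and its mass at time `n` is at most the total
  -- variation distance.
  have hac : (M.law θs ηs).map BayesPOMM.obsSeq ≪ (M.law θs (π θs)).map BayesPOMM.obsSeq := by
    refine C.map_obsSeq_absolutelyContinuous ηs (π θs) rfl ?_
    refine tendsto_of_tendsto_of_tendsto_of_le_of_le tendsto_const_nhds (hTV θs ηs.fst)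
      (fun _ => zero_le) fun n => ?_
    have h := (BayesPOMM.measure_le_add_tvNormSub (ηs.fst.bind (H.QX θs ^ n)) (π θs).fst C.measurableSet).1
    rwa [C.null, zero_add] at h
  have hfin : ∀ᵐ y ∂((M.law θs (π θs)).map BayesPOMM.obsSeq), ∀ n, ∫⁻ θ, M.likSeq θ η n y ∂lam < ⊤ := by
    rw [hP]; exact C.ae_lintegral_likSeq_lt_top lam η
  filter_upwards [ae_of_ae_map BayesPOMM.measurable_obsSeq.aemeasurable (hac.ae_le hden),
    ae_of_ae_map BayesPOMM.measurable_obsSeq.aemeasurable (hac.ae_le hnum),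
    ae_of_ae_map BayesPOMM.measurable_obsSeq.aemeasurable (hac.ae_le hfin)] with ω hd hn hf
  have hp0 : ∀ n : ℕ, ∏ i ∈ Finset.range n, gs (BayesPOMM.obsSeq ω i) ≠ 0 := fun n =>
    Finset.prod_ne_zero_iff.2 fun i _ => C.gs_ne_zero _
  have hpt : ∀ n : ℕ, ∏ i ∈ Finset.range n, gs (BayesPOMM.obsSeq ω i) ≠ ⊤ := fun n =>
    ENNReal.prod_ne_top fun i _ => C.gs_ne_top _
  refine BayesPOMM.eventuallyProbTendstoWeakly_dirac ?_ θs fun r => ?_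
  -- Any rate would do, since only positivity of the denominator is needed.
  · obtain ⟨c, hc0, -, hc⟩ := hd 0
    filter_upwards [hc] with n hn'
    refine M.isProbabilityMeasure_posterior lam η _ ?_ (hf n).ne
    refine ((pos_iff_ne_zero.2 (mul_ne_zero hc0 (mul_ne_zero ?_ (hp0 n)))).trans_le hn').ne'
    simp [Real.exp_pos]
  · obtain ⟨j, hj⟩ := hn r
    obtain ⟨c, hc0, hct, hc⟩ := hd j
    have hA : MeasurableSet {θ | 1 / ((r : ℝ) + 1) ≤ dist θ θs} :=
      (isClosed_le continuous_const (by fun_prop)).measurableSet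
    simp only [M.posterior_apply lam η _ hA]
    refine BayesPOMM.tendsto_inv_mul_zero hc0 hct
      (measure_ne_top lam {θ | 1 / ((r : ℝ) + 1) ≤ dist θ θs}) (by positivity) hp0 hpt hc ?_
    filter_upwards [hj] with n hn'
    refine hn'.trans (le_of_eq ?_)
    congr 5
    field_simp
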